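/- Let $n\ge 1$ and let $Q_0\subset\mathbb{R}^n$ be a cube with sides parallel to the axes. Let $\mathcal D(Q_0)$ be the collection of dyadic subcubes of $Q_0$ (those obtained by dividing $Q_0$ into $2^{kn}$ congruent cubes, $k=0,1,2,\dots$). Write $f_Q=\frac1{|Q|}\int_Q f$. For a family $\mathcal S\subset\mathcal D(Q_0)$ and $Q\in\mathcal S$, let $\mathrm{Ch}_{\mathcal S}(Q)$ be the set of maximal (for inclusion) cubes of $\mathcal S$ strictly contained in $Q$, and call $\mathcal S$ sparse if $\sum_{Q'\in \mathrm{Ch}_{\mathcal S}(Q)}|Q'|\le\frac12|Q|$ for every $Q\in\mathcal S$. For $1\le p\le\infty$ and $f\in L^1(Q_0)$ put $$\|f\|_{SJN_p(Q_0)}=\sup_{\mathcal S\ \text{sparse}}\Big\|\sum_{Q\in\mathcal S}\Big(\frac1{|Q|}\int_Q|f-f_Q|\,dx\Big)\mathbf 1_{Q\setminus\bigcup_{Q'\in \mathrm{Ch}_{\mathcal S}(Q)}Q'}\Big\|_{L^p(Q_0)},$$ and let $SJN_p(Q_0)$ be the set of all $f\in L^1(Q_0)$ for which this is finite. Then: 1.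 If $1<p<\infty$, then $SJN_p(Q_0)=L^p(Q_0)$, and $C^{-1}\|f-f_{Q_0}\|_{L^p(Q_0)}\le\|f\|_{SJN_p(Q_0)}\le C\|f-f_{Q_0}\|_{L^p(Q_0)}$ for all $f\in L^1(Q_0)$, with $C$ depending only on $n$ and $p$. 2. If $p=\infty$, then $SJN_\infty(Q_0)$ is the space $\mathrm{BMO}$ on $Q_0$ relative to the cubes of $\mathcal D(Q_0)$, with $$\|f\|_{SJN_\infty(Q_0)}=\sup_{Q\in\mathcal D(Q_0)}\frac1{|Q|}\int_Q|f-f_Q|\,dx \qquad (f\in L^1(Q_0)).$$ The space $\mathrm{BMO}(Q_0)$ with respect to all subcubes of $Q_0$ (with sides parallel to the axes) is contained in $SJN_\infty(Q_0)$ and is the set of $f\in L^1(Q_0)$ that lie in $SJN_\infty(Q)$ uniformly over all subcubes $Q\subset Q_0$, with $$\|f\|_{\mathrm{BMO}(Q_0)}=\sup_{Q\subset Q_0}\frac1{|Q|}\int_Q|f-f_Q|\,dx=\sup_{Q\subset Q_0}\|f\|_{SJN_\infty(Q)} \qquad (f\in L^1(Q_0)).$$ 3. If $p=1$, then $SJN_1(Q_0)=L\log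 L(Q_0)$, the set of measurable $f$ with $\int_{Q_0}|f|\log^+|f|\,dx<\infty$, and for all $f\in L^1(Q_0)$ $$C^{-1}\,|Q_0|\,\|f-f_{Q_0}\|_{L\log L,Q_0}\le\|f\|_{SJN_1(Q_0)}\le C\,|Q_0|\,\|f-f_{Q_0}\|_{L\log L,Q_0},$$ with $C$ depending only on $n$, where $\|g\|_{L\log L,Q_0}=\inf\{t>0:\frac1{|Q_0|}\int_{Q_0}\frac{|g|}t\log\big(e+\frac{|g|}t\big)dx\le1\}$, which is $\infty$ if there is no such $t$. -/

import Mathlib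

open MeasureTheory Set
open scoped ENNReal NNReal

noncomputable section

/-- The (half-open) cube with sides parallel to the axes, lower corner `a` and side length `ℓ`.
Boundaries are Lebesgue null, so half-open and closed cubes carry the same function spaces. -/
def axisCube {n : ℕ} (a : Fin n → ℝ) (ℓ : ℝ) : Set (Fin n → ℝ) :=
  Set.univ.pi fun i => Set.Ico (a i) (a i + ℓ)

/-- `Q` is a (nondegenerate) cube with sides parallel to the axes. -/
def IsCube {n : ℕ} (Q : Set (Fin n → ℝ)) : Prop :=
  ∃ (a : Fin n → ℝ) (ℓ : ℝ), 0 < ℓ ∧ Q = axisCube a ℓ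

/-- The dyadic subcubes of the cube `Q₀`: the cubes obtained by dividing `Q₀`, for some `k`, into
`2 ^ (k n)` congruent cubes of side length `ℓ / 2 ^ k`. -/
def dyadicSubcubes {n : ℕ} (Q₀ : Set (Fin n → ℝ)) : Set (Set (Fin n → ℝ)) :=
  {Q | ∃ (a : Fin n → ℝ) (ℓ : ℝ), 0 < ℓ ∧ Q₀ = axisCube a ℓ ∧
    ∃ (k : ℕ) (m : Fin n → ℕ), (∀ i, m i < 2 ^ k) ∧
      Q = axisCube (fun i => a i + (m i : ℝ) * (ℓ / 2 ^ k)) (ℓ / 2 ^ k)}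

/-- The children of `Q` in the family `S`: the maximal (for inclusion) members of `S` that are
strictly contained in `Q`. -/
def sparseChildren {n : ℕ} (S : Set (Set (Fin n → ℝ))) (Q : Set (Fin n → ℝ)) :
    Set (Set (Fin n → ℝ)) :=
  {Q' | Maximal (fun R => R ∈ S ∧ R ⊂ Q) Q'}

/-- `S` is a sparse family of dyadic subcubes of `Q₀`. -/
def IsSparseFamily {n : ℕ} (Q₀ : Set (Fin n → ℝ)) (S : Set (Set (Fin n → ℝ))) : Prop :=
  S ⊆ dyadicSubcubes Q₀ ∧
    ∀ Q ∈ S, (∑' Q' : sparseChildren S Q, volume (Q' : Set (Fin n → ℝ))) ≤ volume Q / 2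

/-- The mean oscillation `|Q|⁻¹ ∫_Q |f - f_Q|`. -/
def meanOsc {n : ℕ} (f : (Fin n → ℝ) → ℝ) (Q : Set (Fin n → ℝ)) : ℝ≥0∞ :=
  ⨍⁻ x in Q, ‖f x - ⨍ y in Q, f y‖ₑ ∂volume

/-- The oscillation sum of `f` along the family `S`: the mean oscillation of `f` over `Q` times the
indicator of `Q` minus its children, summed over `Q ∈ S`. -/
def sparseOsc {n : ℕ} (f : (Fin n → ℝ) → ℝ) (S : Set (Set (Fin n → ℝ))) (x : Fin n → ℝ) : ℝ≥0∞ :=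
  ∑' Q : S, Set.indicator ((Q : Set (Fin n → ℝ)) \ ⋃₀ sparseChildren S Q)
    (fun _ => meanOsc f Q) x

/-- The sparse John-Nirenberg functional. -/
def sjnNorm {n : ℕ} (f : (Fin n → ℝ) → ℝ) (p : ℝ≥0∞) (Q₀ : Set (Fin n → ℝ)) : ℝ≥0∞ :=
  ⨆ (S : Set (Set (Fin n → ℝ))) (_ : IsSparseFamily Q₀ S),
    eLpNorm (sparseOsc f S) p (volume.restrict Q₀)

/-- The sparse John-Nirenberg space. Only the restriction of `f` to `Q₀` matters. -/
def SJN {n : ℕ} (p : ℝ≥0∞) (Q₀ : Set (Fin n → ℝ)) : Set ((Fin n → ℝ) → ℝ) :=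
  {f | IntegrableOn f Q₀ ∧ sjnNorm f p Q₀ < ∞}

/-- The Lebesgue space `L^p(Q₀)`. -/
def LpOn {n : ℕ} (p : ℝ≥0∞) (Q₀ : Set (Fin n → ℝ)) : Set ((Fin n → ℝ) → ℝ) :=
  {f | MemLp f p (volume.restrict Q₀)}

/-- The `BMO(Q₀)` seminorm, a supremum over all subcubes of `Q₀`. -/
def bmoNorm {n : ℕ} (f : (Fin n → ℝ) → ℝ) (Q₀ : Set (Fin n → ℝ)) : ℝ≥0∞ :=
  ⨆ (Q : Set (Fin n → ℝ)) (_ : IsCube Q) (_ : Q ⊆ Q₀), meanOsc f Q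

/-- `BMO(Q₀)`, with respect to all subcubes of `Q₀`. -/
def BMO {n : ℕ} (Q₀ : Set (Fin n → ℝ)) : Set ((Fin n → ℝ) → ℝ) :=
  {f | IntegrableOn f Q₀ ∧ bmoNorm f Q₀ < ∞}

/-- The dyadic `BMO(Q₀)` seminorm, a supremum over the dyadic subcubes of `Q₀`. -/
def dyadicBmoNorm {n : ℕ} (f : (Fin n → ℝ) → ℝ) (Q₀ : Set (Fin n → ℝ)) : ℝ≥0∞ :=
  ⨆ (Q : Set (Fin n → ℝ)) (_ : Q ∈ dyadicSubcubes Q₀), meanOsc f Q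

/-- `BMO(Q₀)` with respect to the dyadic subcubes of `Q₀`. -/
def DyadicBMO {n : ℕ} (Q₀ : Set (Fin n → ℝ)) : Set ((Fin n → ℝ) → ℝ) :=
  {f | IntegrableOn f Q₀ ∧ dyadicBmoNorm f Q₀ < ∞}

/-- The Zygmund space `L log L (Q₀)`: measurable `f` with `∫ |f| log⁺ |f| < ∞`. -/
def LLogL {n : ℕ} (Q₀ : Set (Fin n → ℝ)) : Set ((Fin n → ℝ) → ℝ) :=
  {f | AEStronglyMeasurable f (volume.restrict Q₀) ∧
    (∫⁻ x in Q₀, ENNReal.ofReal (|f x| * Real.posLog |f x|)) < ∞}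

/-- The Luxemburg norm of `L log L (Q₀)`, for the Young function `t log (e + t)` and the normalized
Lebesgue measure on `Q₀`; it is `∞` when no `t` is admissible. -/
def llogLNorm {n : ℕ} (f : (Fin n → ℝ) → ℝ) (Q₀ : Set (Fin n → ℝ)) : ℝ≥0∞ :=
  ⨅ (t : ℝ) (_ : 0 < t)
    (_ : (⨍⁻ x in Q₀, ENNReal.ofReal (|f x| / t * Real.log (Real.exp 1 + |f x| / t)) ∂volume) ≤ 1),
    ENNReal.ofReal t

end

/-! Let `M` be the dyadic maximal operator of `Q₀` and `g = |f - f_{Q₀}|`. For `1 ≤ p < ∞` the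
functional `sjnNorm f p Q₀` is comparable with the `L^p` norm of `M g`, and the theorem follows from
classical facts about `M`.

Upper bound: the sets `Q` minus its children are pairwise disjoint for `Q` in the family, so at each
point `sparseOsc` is at most one mean oscillation, which is at most `2 M g`
(`sparseOsc_le_dyadicMax`).

Lower bound: a stopping-time family `oscFamily` is built by selecting inside `Q` the maximal cubes
where the average of `|f - f_Q|` exceeds twice its average on `Q`. Chebyshev makes it sparse, and
telescoping the means along the selected cubes gives `M g ≤ 2^(n+1) * fullOsc`
(`dyadicMax_le_fullOsc`). Here `fullOsc` sums oscillations over whole cubes rather than over the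
disjoint parts. The passage to `sparseOsc` is a duality argument: a sparse cube has at most twice
the measure of its part, so `∫ fullOsc * ψ ≤ 2 ∫ sparseOsc * M ψ` (`lintegral_fullOsc_mul_le`). For
`p = 1` take `ψ = 1`; for `1 < p < ∞` take a truncation of `fullOsc ^ (p - 1)` and use that `M` is
bounded on the conjugate space.

Conclusion: for `1 < p < ∞`, `M` is bounded on `L^p` and `g ≤ M g` almost everywhere. For `p = 1`,
`∫ M g` is comparable with the Luxemburg norm, by the `L log L` maximal bound and Stein's converse.
For `p = ∞`, singletons are sparse families, so the supremum is the dyadic `BMO` seminorm. -/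

noncomputable section

/-! ### Dyadic grids -/

/-- The dyadic cubes of level `k` in the cube with corner `a` and side length `ℓ`. -/
def dyadicLevel {n : ℕ} (a : Fin n → ℝ) (ℓ : ℝ) (k : ℕ) : Set (Set (Fin n → ℝ)) :=
  {Q | ∃ m : Fin n → ℕ, (∀ i, m i < 2 ^ k) ∧
    Q = axisCube (fun i => a i + (m i : ℝ) * (ℓ / 2 ^ k)) (ℓ / 2 ^ k)}

/-- The combinatorial and measure theoretic properties of the levels of a dyadic grid. -/
structure IsDyadicGrid {n : ℕ} (Q₀ : Set (Fin n → ℝ)) (lev : ℕ → Set (Set (Fin n → ℝ))) :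
    Prop where
  zero : lev 0 = {Q₀}
  measurableSet : ∀ {k Q}, Q ∈ lev k → MeasurableSet Q
  volume_ne_zero : ∀ {k Q}, Q ∈ lev k → volume Q ≠ 0
  volume_ne_top : ∀ {k Q}, Q ∈ lev k → volume Q ≠ ∞
  countable : ∀ k, (lev k).Countable
  nested : ∀ {j k Q R}, j ≤ k → Q ∈ lev j → R ∈ lev k → (Q ∩ R).Nonempty → R ⊆ Q
  parent : ∀ {k R}, R ∈ lev (k + 1) → ∃ P ∈ lev k, R ⊂ P ∧ volume P = 2 ^ n * volume R
  mem_iff : ∀ Q, Q ∈ dyadicSubcubes Q₀ ↔ ∃ k, Q ∈ lev k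

lemma mem_axisCube {n : ℕ} {a : Fin n → ℝ} {ℓ : ℝ} {x : Fin n → ℝ} :
    x ∈ axisCube a ℓ ↔ ∀ i, a i ≤ x i ∧ x i < a i + ℓ := by
  simp [axisCube, Set.mem_pi]

lemma measurableSet_axisCube {n : ℕ} (a : Fin n → ℝ) (ℓ : ℝ) : MeasurableSet (axisCube a ℓ) :=
  MeasurableSet.univ_pi fun _ => measurableSet_Ico

lemma volume_axisCube {n : ℕ} (a : Fin n → ℝ) (ℓ : ℝ) :
    volume (axisCube a ℓ) = ENNReal.ofReal ℓ ^ n := by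
  simp [axisCube, volume_pi_pi]

/-- In dimension zero all cubes coincide, so the side length can only be read off when `1 ≤ n`. This
makes the existential corner and side in `dyadicSubcubes` unambiguous. -/
lemma axisCube_injective {n : ℕ} (hn : 1 ≤ n) {a b : Fin n → ℝ} {ℓ r : ℝ} (hℓ : 0 < ℓ)
    (hr : 0 < r) (h : axisCube a ℓ = axisCube b r) : a = b ∧ ℓ = r := by
  have ne : ∀ (c : Fin n → ℝ) (s : ℝ), 0 < s → (axisCube c s).Nonempty := fun c s hs =>
    ⟨c, mem_axisCube.2 fun i => ⟨le_rfl, by linarith⟩⟩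
  have key : ∀ i, Ico (a i) (a i + ℓ) = Ico (b i) (b i + r) := by
    intro i
    have h1 := Set.eval_image_univ_pi (i := i) (ne a ℓ hℓ)
    have h2 := Set.eval_image_univ_pi (i := i) (ne b r hr)
    rw [← h1, ← h2]
    exact congrArg _ h
  have hab : ∀ i, a i = b i := by
    intro i
    have := congrArg sInf (key i)
    rwa [csInf_Ico (by linarith), csInf_Ico (by linarith)] at this
  refine ⟨funext hab, ?_⟩
  have := congrArg sSup (key ⟨0, hn⟩)
  rw [csSup_Ico (by linarith), csSup_Ico (by linarith), hab] at this
  linarith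

lemma IsCube.measurableSet {n : ℕ} {Q : Set (Fin n → ℝ)} (h : IsCube Q) : MeasurableSet Q := by
  obtain ⟨a, ℓ, -, rfl⟩ := h
  exact measurableSet_axisCube a ℓ

lemma IsCube.volume_ne_zero {n : ℕ} {Q : Set (Fin n → ℝ)} (h : IsCube Q) : volume Q ≠ 0 := by
  obtain ⟨a, ℓ, hℓ, rfl⟩ := h
  rw [volume_axisCube]
  exact pow_ne_zero _ (by simpa using hℓ)

lemma IsCube.volume_ne_top {n : ℕ} {Q : Set (Fin n → ℝ)} (h : IsCube Q) : volume Q ≠ ∞ := by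
  obtain ⟨a, ℓ, hℓ, rfl⟩ := h
  rw [volume_axisCube]
  exact ENNReal.pow_ne_top ENNReal.ofReal_ne_top

lemma isCube_of_mem_dyadicLevel {n : ℕ} {a : Fin n → ℝ} {ℓ : ℝ} (hℓ : 0 < ℓ) {k : ℕ}
    {Q : Set (Fin n → ℝ)} (h : Q ∈ dyadicLevel a ℓ k) : IsCube Q := by
  obtain ⟨m, -, rfl⟩ := h
  exact ⟨_, _, by positivity, rfl⟩

lemma isCube_of_mem_dyadicSubcubes {n : ℕ} {Q₀ Q : Set (Fin n → ℝ)}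
    (h : Q ∈ dyadicSubcubes Q₀) : IsCube Q := by
  obtain ⟨a, ℓ, hℓ, -, k, m, hm, rfl⟩ := h
  exact ⟨_, _, by positivity, rfl⟩

/-- All endpoints are integers, so the strict inequalities forced by the common point `y` improve to
the non-strict ones that express nesting. This is the one-dimensional core of `dyadicLevel_nested`,
in units of the finer side length. -/
lemma nat_interval_nested {D m m' : ℕ} {y : ℝ} (h1 : (m * D : ℝ) ≤ y) (h2 : y < (m + 1) * D)
    (h3 : (m' : ℝ) ≤ y) (h4 : y < m' + 1) :
    (m * D : ℝ) ≤ m' ∧ (m' + 1 : ℝ) ≤ (m + 1) * D := by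
  have h5 : m * D < m' + 1 := by exact_mod_cast h1.trans_lt h4
  have h6 : m' < (m + 1) * D := by exact_mod_cast h3.trans_lt h2
  exact ⟨by exact_mod_cast Nat.lt_succ_iff.1 h5, by exact_mod_cast h6⟩

lemma dyadicLevel_nested {n : ℕ} {a : Fin n → ℝ} {ℓ : ℝ} (hℓ : 0 < ℓ) {j k : ℕ}
    {Q R : Set (Fin n → ℝ)} (hjk : j ≤ k) (hQ : Q ∈ dyadicLevel a ℓ j)
    (hR : R ∈ dyadicLevel a ℓ k) (hne : (Q ∩ R).Nonempty) : R ⊆ Q := by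
  obtain ⟨m, -, rfl⟩ := hQ
  obtain ⟨m', -, rfl⟩ := hR
  obtain ⟨x, hx, hx'⟩ := hne
  rw [mem_axisCube] at hx hx'
  intro z hz
  rw [mem_axisCube] at hz ⊢
  intro i
  obtain ⟨d, rfl⟩ := Nat.exists_eq_add_of_le hjk
  set δ := ℓ / 2 ^ (j + d) with hδ
  have hδ0 : 0 < δ := by positivity
  have e : ℓ / 2 ^ j = ((2 ^ d : ℕ) : ℝ) * δ := by
    rw [hδ, pow_add]; push_cast; field_simp
  obtain ⟨h1, h2⟩ := hx i
  obtain ⟨h3, h4⟩ := hx' i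
  obtain ⟨h5, h6⟩ := hz i
  rw [e] at h1 h2 ⊢
  generalize 2 ^ d = D at *
  have := nat_interval_nested (D := D) (m := m i) (m' := m' i) (y := (x i - a i) / δ)
    (by rw [le_div_iff₀ hδ0]; linarith) (by rw [div_lt_iff₀ hδ0]; linarith)
    (by rw [le_div_iff₀ hδ0]; linarith) (by rw [div_lt_iff₀ hδ0]; linarith)
  constructor
  · nlinarith [mul_le_mul_of_nonneg_right this.1 hδ0.le]
  · nlinarith [mul_le_mul_of_nonneg_right this.2 hδ0.le]

lemma dyadicLevel_parent {n : ℕ} {a : Fin n → ℝ} {ℓ : ℝ} (hℓ : 0 < ℓ) {k : ℕ}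
    {R : Set (Fin n → ℝ)} (hR : R ∈ dyadicLevel a ℓ (k + 1)) :
    ∃ P ∈ dyadicLevel a ℓ k, R ⊆ P ∧ volume P = 2 ^ n * volume R := by
  obtain ⟨m, hm, rfl⟩ := hR
  refine ⟨_, ⟨fun i => m i / 2, fun i => ?_, rfl⟩, ?_, ?_⟩
  · have := hm i
    rw [pow_succ] at this
    exact Nat.div_lt_of_lt_mul (by rwa [mul_comm])
  · intro x hx
    rw [mem_axisCube] at hx ⊢
    intro i
    obtain ⟨h1, h2⟩ := hx i
    set δ := ℓ / 2 ^ (k + 1) with hδ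
    have hδ0 : 0 < δ := by positivity
    have e : ℓ / 2 ^ k = 2 * δ := by rw [hδ, pow_succ]; field_simp
    have h3 : ((m i / 2 : ℕ) : ℝ) * 2 ≤ m i := by exact_mod_cast Nat.div_mul_le_self _ _
    have h4 : (m i : ℝ) + 1 ≤ ((m i / 2 : ℕ) : ℝ) * 2 + 2 := by
      exact_mod_cast (by omega : m i + 1 ≤ m i / 2 * 2 + 2)
    rw [e]
    constructor
    · nlinarith [mul_le_mul_of_nonneg_right h3 hδ0.le]
    · nlinarith [mul_le_mul_of_nonneg_right h4 hδ0.le]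
  · rw [volume_axisCube, volume_axisCube, ← mul_pow]
    congr 1
    rw [show (2 : ℝ≥0∞) = ENNReal.ofReal 2 by simp, ← ENNReal.ofReal_mul (by norm_num)]
    congr 1
    rw [pow_succ]; field_simp

lemma isDyadicGrid_dyadicLevel {n : ℕ} (hn : 1 ≤ n) (a : Fin n → ℝ) {ℓ : ℝ} (hℓ : 0 < ℓ) :
    IsDyadicGrid (axisCube a ℓ) (dyadicLevel a ℓ) where
  zero := by
    ext Q
    simp only [dyadicLevel, pow_zero, Nat.lt_one_iff, div_one, mem_ofPred_eq, mem_singleton_iff]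
    constructor
    · rintro ⟨m, hm, rfl⟩
      simp [hm]
    · rintro rfl
      exact ⟨0, by simp⟩
  measurableSet h := (isCube_of_mem_dyadicLevel hℓ h).measurableSet
  volume_ne_zero h := (isCube_of_mem_dyadicLevel hℓ h).volume_ne_zero
  volume_ne_top h := (isCube_of_mem_dyadicLevel hℓ h).volume_ne_top
  countable k := by
    refine (Set.countable_range fun m : Fin n → ℕ =>
      axisCube (fun i => a i + (m i : ℝ) * (ℓ / 2 ^ k)) (ℓ / 2 ^ k)).mono ?_
    rintro Q ⟨m, -, rfl⟩
    exact ⟨m, rfl⟩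
  nested := dyadicLevel_nested hℓ
  parent {k R} hR := by
    obtain ⟨P, hP, hRP, hv⟩ := dyadicLevel_parent hℓ hR
    refine ⟨P, hP, ⟨hRP, fun hPR => ?_⟩, hv⟩
    have hR' := isCube_of_mem_dyadicLevel hℓ hR
    -- Equality with the parent would give `2 ^ n ≤ 1`, which fails because `1 ≤ n`.
    have h1 : (2 : ℝ≥0∞) ^ n * volume R ≤ 1 * volume R := by
      rw [← hv, one_mul]; exact measure_mono hPR
    rw [ENNReal.mul_le_mul_iff_left hR'.volume_ne_zero hR'.volume_ne_top] at h1
    exact absurd h1 (not_le.2 (one_lt_pow₀ (by norm_num) (by omega)))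
  mem_iff Q := by
    constructor
    · rintro ⟨b, r, hr, h, k, m, hm, rfl⟩
      obtain ⟨rfl, rfl⟩ := axisCube_injective hn hℓ hr h
      exact ⟨k, m, hm, rfl⟩
    · rintro ⟨k, m, hm, rfl⟩
      exact ⟨a, ℓ, hℓ, rfl, k, m, hm, rfl⟩

lemma IsCube.exists_isDyadicGrid {n : ℕ} (hn : 1 ≤ n) {Q₀ : Set (Fin n → ℝ)} (h : IsCube Q₀) :
    ∃ lev, IsDyadicGrid Q₀ lev := by
  obtain ⟨a, ℓ, hℓ, rfl⟩ := h
  exact ⟨_, isDyadicGrid_dyadicLevel hn a hℓ⟩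

lemma exists_mem_dyadicLevel {n : ℕ} {a : Fin n → ℝ} {ℓ : ℝ} (hℓ : 0 < ℓ) {x : Fin n → ℝ}
    (hx : x ∈ axisCube a ℓ) (k : ℕ) :
    ∃ b, x ∈ axisCube b (ℓ / 2 ^ k) ∧ axisCube b (ℓ / 2 ^ k) ∈ dyadicLevel a ℓ k := by
  rw [mem_axisCube] at hx
  set δ := ℓ / 2 ^ k with hδ
  have hδ0 : 0 < δ := by positivity
  refine ⟨fun i => a i + (⌊(x i - a i) / δ⌋₊ : ℝ) * δ, ?_, fun i => ⌊(x i - a i) / δ⌋₊, ?_, rfl⟩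
  · rw [mem_axisCube]
    intro i
    have h0 : 0 ≤ (x i - a i) / δ := div_nonneg (by linarith [(hx i).1]) hδ0.le
    have h1 := Nat.floor_le h0
    have h2 := Nat.lt_floor_add_one ((x i - a i) / δ)
    rw [le_div_iff₀ hδ0] at h1
    rw [div_lt_iff₀ hδ0] at h2
    constructor <;> linarith
  · intro i
    have h0 : 0 ≤ (x i - a i) / δ := div_nonneg (by linarith [(hx i).1]) hδ0.le
    rw [Nat.floor_lt h0, div_lt_iff₀ hδ0, hδ]
    push_cast
    rw [mul_div_cancel₀ _ (by positivity)]
    linarith [(hx i).2]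

namespace IsDyadicGrid

variable {n : ℕ} {Q₀ : Set (Fin n → ℝ)} {lev : ℕ → Set (Set (Fin n → ℝ))}

lemma mem_self (h : IsDyadicGrid Q₀ lev) : Q₀ ∈ dyadicSubcubes Q₀ :=
  (h.mem_iff _).2 ⟨0, by simp [h.zero]⟩

lemma countable_dyadicSubcubes (h : IsDyadicGrid Q₀ lev) : (dyadicSubcubes Q₀).Countable := by
  have : dyadicSubcubes Q₀ = ⋃ k, lev k := by
    ext Q; simp [h.mem_iff]
  rw [this]
  exact countable_iUnion h.countable

lemma subset_or_subset (h : IsDyadicGrid Q₀ lev) {Q R : Set (Fin n → ℝ)}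
    (hQ : Q ∈ dyadicSubcubes Q₀) (hR : R ∈ dyadicSubcubes Q₀) (hne : (Q ∩ R).Nonempty) :
    Q ⊆ R ∨ R ⊆ Q := by
  obtain ⟨j, hj⟩ := (h.mem_iff _).1 hQ
  obtain ⟨k, hk⟩ := (h.mem_iff _).1 hR
  rcases le_total j k with hjk | hjk
  · exact Or.inr (h.nested hjk hj hk hne)
  · exact Or.inl (h.nested hjk hk hj (by rwa [inter_comm]))

lemma nonempty (h : IsDyadicGrid Q₀ lev) {Q : Set (Fin n → ℝ)} (hQ : Q ∈ dyadicSubcubes Q₀) :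
    Q.Nonempty := by
  obtain ⟨j, hj⟩ := (h.mem_iff _).1 hQ
  exact nonempty_of_measure_ne_zero (h.volume_ne_zero hj)

lemma level_lt_of_ssubset (h : IsDyadicGrid Q₀ lev) {Q R : Set (Fin n → ℝ)} {j k : ℕ}
    (hQ : Q ∈ lev j) (hR : R ∈ lev k) (hRQ : R ⊂ Q) : j < k := by
  by_contra hk
  refine hRQ.2 (h.nested (not_lt.1 hk) hR hQ ?_)
  rw [inter_eq_left.2 hRQ.1]
  exact nonempty_of_measure_ne_zero (h.volume_ne_zero hR)

lemma subset_root (h : IsDyadicGrid Q₀ lev) {Q : Set (Fin n → ℝ)}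
    (hQ : Q ∈ dyadicSubcubes Q₀) : Q ⊆ Q₀ := by
  obtain ⟨j, hj⟩ := (h.mem_iff _).1 hQ
  clear hQ
  induction j generalizing Q with
  | zero => rw [h.zero] at hj; exact hj.subset
  | succ k ih =>
    obtain ⟨P, hP, hQP, -⟩ := h.parent hj
    exact hQP.1.trans (ih hP)

/-- Larger cubes have smaller levels, and levels are natural numbers: a cube of least level among
those containing `Q` and satisfying `p` is maximal. -/
lemma exists_maximal (h : IsDyadicGrid Q₀ lev) {p : Set (Fin n → ℝ) → Prop}
    (hp : ∀ Q, p Q → Q ∈ dyadicSubcubes Q₀) {Q : Set (Fin n → ℝ)} (hQ : p Q) :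
    ∃ R, Maximal p R ∧ Q ⊆ R := by
  classical
  have hex : ∃ k, ∃ R ∈ lev k, p R ∧ Q ⊆ R := by
    obtain ⟨k, hk⟩ := (h.mem_iff _).1 (hp Q hQ)
    exact ⟨k, Q, hk, hQ, subset_rfl⟩
  obtain ⟨R, hR, hpR, hQR⟩ := Nat.find_spec hex
  refine ⟨R, ⟨hpR, fun R' hR' hRR' => ?_⟩, hQR⟩
  obtain ⟨j, hj⟩ := (h.mem_iff _).1 (hp R' hR')
  refine h.nested (Nat.find_min' hex ⟨R', hj, hR', hQR.trans hRR'⟩) hR hj ?_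
  rw [inter_eq_left.2 hRR']
  exact h.nonempty (hp R hpR)

lemma pairwiseDisjoint_maximal (h : IsDyadicGrid Q₀ lev) {p : Set (Fin n → ℝ) → Prop}
    (hp : ∀ Q, p Q → Q ∈ dyadicSubcubes Q₀) : {Q | Maximal p Q}.PairwiseDisjoint id := by
  intro Q hQ R hR hne
  by_contra hd
  rw [Function.onFun, id, id, not_disjoint_iff_nonempty_inter] at hd
  rcases h.subset_or_subset (hp Q hQ.1) (hp R hR.1) hd with hs | hs
  · exact hne (hQ.eq_of_subset hR.1 hs)
  · exact hne (hR.eq_of_subset hQ.1 hs).symm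

/-- A dyadic cube strictly contained in `Q` has a dyadic parent inside `Q`. -/
lemma exists_parent (h : IsDyadicGrid Q₀ lev) {Q R : Set (Fin n → ℝ)}
    (hQ : Q ∈ dyadicSubcubes Q₀) (hR : R ∈ dyadicSubcubes Q₀) (hRQ : R ⊂ Q) :
    ∃ P ∈ dyadicSubcubes Q₀, R ⊂ P ∧ P ⊆ Q ∧ volume P = 2 ^ n * volume R := by
  obtain ⟨j, hj⟩ := (h.mem_iff _).1 hQ
  obtain ⟨k, hk⟩ := (h.mem_iff _).1 hR
  have hjk := h.level_lt_of_ssubset hj hk hRQ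
  obtain ⟨k, rfl⟩ : ∃ i, k = i + 1 := ⟨k - 1, by omega⟩
  obtain ⟨P, hP, hRP, hv⟩ := h.parent hk
  refine ⟨P, (h.mem_iff _).2 ⟨k, hP⟩, hRP, h.nested (by omega) hj hP ?_, hv⟩
  obtain ⟨x, hx⟩ := h.nonempty hR
  exact ⟨x, hRQ.1 hx, hRP.1 hx⟩

end IsDyadicGrid

/-! ### The dyadic maximal function and Lebesgue differentiation -/

/-- The dyadic maximal function over the dyadic subcubes of `Q₀`. -/
def dyadicMax {n : ℕ} (Q₀ : Set (Fin n → ℝ)) (g : (Fin n → ℝ) → ℝ≥0∞) (x : Fin n → ℝ) : ℝ≥0∞ :=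
  ⨆ Q ∈ dyadicSubcubes Q₀, Q.indicator (fun _ => (∫⁻ y in Q, g y) / volume Q) x

lemma average_le_dyadicMax {n : ℕ} {Q₀ Q : Set (Fin n → ℝ)} (g : (Fin n → ℝ) → ℝ≥0∞)
    {x : Fin n → ℝ} (hQ : Q ∈ dyadicSubcubes Q₀) (hx : x ∈ Q) :
    (∫⁻ y in Q, g y) / volume Q ≤ dyadicMax Q₀ g x := by
  refine le_iSup₂_of_le Q hQ ?_
  rw [indicator_of_mem hx]

lemma lt_dyadicMax_iff {n : ℕ} {Q₀ : Set (Fin n → ℝ)} {g : (Fin n → ℝ) → ℝ≥0∞}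
    {x : Fin n → ℝ} {t : ℝ≥0∞} :
    t < dyadicMax Q₀ g x ↔ ∃ Q ∈ dyadicSubcubes Q₀, x ∈ Q ∧ t < (∫⁻ y in Q, g y) / volume Q := by
  simp only [dyadicMax, lt_iSup_iff]
  constructor
  · rintro ⟨Q, hQ, h⟩
    by_cases hx : x ∈ Q
    · exact ⟨Q, hQ, hx, by rwa [indicator_of_mem hx] at h⟩
    · rw [indicator_of_notMem hx] at h
      simp at h
  · rintro ⟨Q, hQ, hx, h⟩
    exact ⟨Q, hQ, by rwa [indicator_of_mem hx]⟩

/-- Balls of the sup metric are cubes, which makes the differentiation theorem for doubling measures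
applicable to dyadic averages. -/
lemma axisCube_ae_eq_closedBall {n : ℕ} (b : Fin n → ℝ) {s : ℝ} (hs : 0 < s) :
    axisCube b s =ᵐ[volume] Metric.closedBall (fun i => b i + s / 2) (s / 2) := by
  have h1 : Metric.closedBall (fun i => b i + s / 2) (s / 2) = Icc b (fun i => b i + s) := by
    rw [closedBall_pi _ (by positivity), ← pi_univ_Icc]
    congr 1
    ext i : 1
    rw [Real.closedBall_eq_Icc]
    congr 1 <;> ring
  rw [h1]
  exact Measure.univ_pi_Ico_ae_eq_Icc

lemma ae_enorm_le_dyadicMax {n : ℕ} {Q₀ : Set (Fin n → ℝ)} (hQ₀ : IsCube Q₀)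
    {g : (Fin n → ℝ) → ℝ} (hg : IntegrableOn g Q₀) :
    ∀ᵐ x ∂volume.restrict Q₀, ‖g x‖ₑ ≤ dyadicMax Q₀ (fun y => ‖g y‖ₑ) x := by
  obtain ⟨a, ℓ, hℓ, rfl⟩ := hQ₀
  have hm := measurableSet_axisCube a ℓ
  set F : (Fin n → ℝ) → ℝ := (axisCube a ℓ).indicator fun x => ‖g x‖ with hF
  have hFi : Integrable F := (integrable_indicator_iff hm).2 hg.norm
  rw [ae_restrict_iff' hm]
  -- The dyadic cubes around `x` are not centred at `x`. The parameter `1` allows any balls that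
  -- contain `x`.
  filter_upwards [IsUnifLocDoublingMeasure.ae_tendsto_average (volume : Measure (Fin n → ℝ))
    hFi.locallyIntegrable 1] with x hx hxQ
  choose b hb hbQ using exists_mem_dyadicLevel hℓ hxQ
  have hpos : ∀ k : ℕ, 0 < ℓ / 2 ^ k := fun k => by positivity
  have hlim : Filter.Tendsto (fun k : ℕ => ℓ / 2 ^ k / 2) Filter.atTop (nhdsWithin 0 (Ioi 0)) := by
    refine tendsto_nhdsWithin_iff.2 ⟨?_, Filter.Eventually.of_forall fun k => by
      have := hpos k
      simp only [mem_Ioi]; positivity⟩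
    have h1 : Filter.Tendsto (fun k : ℕ => ℓ / 2 * (1 / 2 : ℝ) ^ k) Filter.atTop (nhds 0) := by
      simpa using (tendsto_pow_atTop_nhds_zero_of_lt_one (by norm_num : (0 : ℝ) ≤ 1 / 2)
        (by norm_num)).const_mul (ℓ / 2)
    refine h1.congr fun k => ?_
    rw [div_pow, one_pow]; ring
  have hball : ∀ k, x ∈ Metric.closedBall (fun i => b k i + ℓ / 2 ^ k / 2)
      (1 * (ℓ / 2 ^ k / 2)) := by
    intro k
    have hp := hpos k
    rw [one_mul, closedBall_pi _ (by positivity)]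
    intro i _
    have := mem_axisCube.1 (hb k) i
    simp only [Real.closedBall_eq_Icc, mem_Icc]
    constructor <;> linarith [this.1, this.2]
  have ht := hx (fun (k : ℕ) i => b k i + ℓ / 2 ^ k / 2) (fun k => ℓ / 2 ^ k / 2) hlim
    (Filter.Eventually.of_forall hball)
  have hFx : ENNReal.ofReal (F x) = ‖g x‖ₑ := by
    rw [hF, indicator_of_mem hxQ, ofReal_norm]
  have ht' := ENNReal.tendsto_ofReal ht
  rw [hFx] at ht'
  refine le_of_tendsto ht' (Filter.Eventually.of_forall fun k => ?_)
  have hQ : axisCube (b k) (ℓ / 2 ^ k) ∈ dyadicSubcubes (axisCube a ℓ) := by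
    obtain ⟨m, hm, h⟩ := hbQ k
    exact ⟨a, ℓ, hℓ, rfl, k, m, hm, h⟩
  have hsub : axisCube (b k) (ℓ / 2 ^ k) ⊆ axisCube a ℓ := by
    refine dyadicLevel_nested hℓ (Nat.zero_le k) (j := 0) ?_ (hbQ k) ⟨x, hxQ, hb k⟩
    exact ⟨0, by simp, by simp⟩
  refine le_trans (le_of_eq ?_) (average_le_dyadicMax _ hQ (hb k))
  rw [setAverage_congr (axisCube_ae_eq_closedBall (b k) (hpos k)).symm, setAverage_eq,
    smul_eq_mul, ENNReal.ofReal_mul (by positivity), ENNReal.div_eq_inv_mul]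
  have hv0 := (isCube_of_mem_dyadicSubcubes hQ).volume_ne_zero
  have hvt := (isCube_of_mem_dyadicSubcubes hQ).volume_ne_top
  congr 1
  · rw [measureReal_def, ENNReal.ofReal_inv_of_pos (ENNReal.toReal_pos hv0 hvt),
      ENNReal.ofReal_toReal hvt]
  · rw [← ofReal_integral_norm_eq_lintegral_enorm (hg.mono_set hsub)]
    congr 1
    refine setIntegral_congr_fun (measurableSet_axisCube _ _) fun y hy => ?_
    simp [hF, indicator_of_mem (hsub hy)]

/-! ### Layer-cake formulas -/

/-- The integral of `φ` over the positive reals below `a`. -/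
def primitiveBelow (φ : ℝ → ℝ≥0∞) (a : ℝ≥0∞) : ℝ≥0∞ :=
  ∫⁻ t in {t : ℝ | 0 < t ∧ ENNReal.ofReal t < a}, φ t

lemma primitiveBelow_mono (φ : ℝ → ℝ≥0∞) : Monotone (primitiveBelow φ) := fun _ _ hab =>
  lintegral_mono_set fun _ ht => ⟨ht.1, ht.2.trans_le hab⟩

/-- Tonelli on the region `t < F x`. Infinite values of `F` are allowed, since a maximal function
may take them. -/
lemma lintegral_primitiveBelow {X : Type*} [MeasurableSpace X] (μ : Measure X) [SFinite μ]
    {F : X → ℝ≥0∞} (hF : Measurable F) {φ : ℝ → ℝ≥0∞} (hφ : Measurable φ) :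
    ∫⁻ x, primitiveBelow φ (F x) ∂μ
      = ∫⁻ t in Ioi 0, φ t * μ {x | ENNReal.ofReal t < F x} := by
  have hm : MeasurableSet {z : X × ℝ | ENNReal.ofReal z.2 < F z.1} :=
    measurableSet_lt (ENNReal.measurable_ofReal.comp measurable_snd) (hF.comp measurable_fst)
  have h1 : ∀ x, primitiveBelow φ (F x) = ∫⁻ t in Ioi 0,
      {z : X × ℝ | ENNReal.ofReal z.2 < F z.1}.indicator (fun z => φ z.2) (x, t) := by
    intro x
    have hmx : MeasurableSet {t : ℝ | ENNReal.ofReal t < F x} :=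
      measurableSet_lt ENNReal.measurable_ofReal measurable_const
    have e : {t : ℝ | 0 < t ∧ ENNReal.ofReal t < F x}
        = {t : ℝ | ENNReal.ofReal t < F x} ∩ Ioi 0 := by
      ext t; simp [and_comm]
    rw [primitiveBelow, e, ← Measure.restrict_restrict hmx, ← lintegral_indicator hmx]
    rfl
  simp_rw [h1]
  rw [lintegral_lintegral_swap]
  · refine lintegral_congr fun t => ?_
    have hmt : MeasurableSet {x : X | ENNReal.ofReal t < F x} :=
      measurableSet_lt measurable_const hF
    rw [← setLIntegral_const, ← lintegral_indicator hmt]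
    rfl
  · exact ((hφ.comp measurable_snd).indicator hm).aemeasurable

lemma setOf_ofReal_lt_ofReal {b : ℝ} :
    {t : ℝ | 0 < t ∧ ENNReal.ofReal t < ENNReal.ofReal b} = Ioo 0 b := by
  ext t
  simp only [mem_ofPred_eq, mem_Ioo]
  constructor
  · rintro ⟨h1, h2⟩
    exact ⟨h1, (ENNReal.ofReal_lt_ofReal_iff_of_nonneg h1.le).1 h2⟩
  · rintro ⟨h1, h2⟩
    exact ⟨h1, (ENNReal.ofReal_lt_ofReal_iff_of_nonneg h1.le).2 h2⟩

lemma lintegral_Ioo_ofReal {f : ℝ → ℝ} {a b : ℝ} (hab : a ≤ b)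
    (hf : IntervalIntegrable f volume a b) (h0 : ∀ t ∈ Ioo a b, 0 ≤ f t) :
    ∫⁻ t in Ioo a b, ENNReal.ofReal (f t) = ENNReal.ofReal (∫ t in a..b, f t) := by
  rw [intervalIntegral.integral_of_le hab, integral_Ioc_eq_integral_Ioo,
    ofReal_integral_eq_lintegral_ofReal]
  · exact ((intervalIntegrable_iff_integrableOn_Ioo_of_le hab).1 hf)
  · exact (ae_restrict_iff' measurableSet_Ioo).2 (Filter.Eventually.of_forall h0)

lemma primitiveBelow_rpow_ofReal {r : ℝ} (hr : -1 < r) {b : ℝ} (hb : 0 ≤ b) :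
    primitiveBelow (fun t => ENNReal.ofReal (t ^ r)) (ENNReal.ofReal b)
      = ENNReal.ofReal (b ^ (r + 1) / (r + 1)) := by
  rw [primitiveBelow, setOf_ofReal_lt_ofReal, lintegral_Ioo_ofReal hb
    (intervalIntegral.intervalIntegrable_rpow' hr) fun t ht => Real.rpow_nonneg ht.1.le _,
    integral_rpow (Or.inl hr), Real.zero_rpow (by linarith), sub_zero]

lemma primitiveBelow_rpow {r : ℝ} (hr : -1 < r) (a : ℝ≥0∞) :
    primitiveBelow (fun t => ENNReal.ofReal (t ^ r)) a
      = a ^ (r + 1) / ENNReal.ofReal (r + 1) := by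
  have hfin : ∀ b : ℝ≥0, primitiveBelow (fun t => ENNReal.ofReal (t ^ r)) b
      = (b : ℝ≥0∞) ^ (r + 1) / ENNReal.ofReal (r + 1) := by
    intro b
    have := primitiveBelow_rpow_ofReal hr b.2
    rw [ENNReal.ofReal_div_of_pos (by linarith),
      ← ENNReal.ofReal_rpow_of_nonneg b.2 (by linarith)] at this
    simpa using this
  induction a using ENNReal.recTopCoe with
  | coe b => exact hfin b
  | top =>
    rw [ENNReal.top_rpow_of_pos (by linarith), ENNReal.top_div_of_ne_top ENNReal.ofReal_ne_top]
    refine ENNReal.eq_top_of_forall_nnreal_le fun b => ?_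
    have hr1 : 0 < r + 1 := by linarith
    -- Chosen so that `c ^ (r + 1) / (r + 1) = b`; the primitive at `∞` therefore exceeds every
    -- finite `b`.
    set c : ℝ≥0 := (b * (r + 1).toNNReal) ^ (1 / (r + 1)) with hc
    refine le_trans (le_of_eq ?_) ((hfin c).symm.le.trans (primitiveBelow_mono _ le_top))
    rw [hc, ← ENNReal.coe_rpow_of_nonneg _ hr1.le, ← NNReal.rpow_mul,
      one_div_mul_cancel hr1.ne', NNReal.rpow_one, ENNReal.coe_mul]
    rw [ENNReal.ofReal, ENNReal.mul_div_cancel_right]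
    · simpa using hr1
    · exact ENNReal.coe_ne_top

/-- The primitive of the indicator of `t > 1` is the positive part of `a - 1`. Discarding the levels
`t ≤ 1` avoids the divergence of `∫ dt / t` at zero in the `L log L` estimates. -/
lemma le_one_add_primitiveBelow (a : ℝ≥0∞) :
    a ≤ 1 + primitiveBelow ((Ioi 1).indicator 1) a := by
  refine ENNReal.le_of_forall_nnreal_lt fun b hb => ?_
  rw [← tsub_le_iff_left]
  have h1 : volume (Ioo (1 : ℝ) b) ≤ primitiveBelow ((Ioi 1).indicator 1) a := by
    rw [primitiveBelow, lintegral_indicator_one measurableSet_Ioi,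
      Measure.restrict_apply measurableSet_Ioi]
    refine measure_mono fun t ht => ⟨ht.1, zero_lt_one.trans ht.1, lt_trans ?_ hb⟩
    have := (ENNReal.ofReal_lt_ofReal_iff (zero_lt_one.trans (ht.1.trans ht.2))).2 ht.2
    simpa using this
  refine le_trans (le_of_eq ?_) h1
  rw [Real.volume_Ioo, ENNReal.ofReal_sub _ zero_le_one]
  simp

lemma primitiveBelow_indicator_one_le (a : ℝ≥0∞) :
    primitiveBelow ((Ioi 1).indicator 1) a ≤ a := by
  induction a using ENNReal.recTopCoe with
  | top => exact le_top
  | coe b =>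
    have e : (b : ℝ≥0∞) = ENNReal.ofReal (b : ℝ) := by simp
    rw [primitiveBelow, lintegral_indicator_one measurableSet_Ioi]
    rw [Measure.restrict_apply measurableSet_Ioi, e, setOf_ofReal_lt_ofReal]
    refine (measure_mono inter_subset_right).trans ?_
    rw [Real.volume_Ioo, sub_zero]

lemma primitiveBelow_indicator_inv {b : ℝ} (hb : 0 ≤ b) :
    primitiveBelow ((Ioi 1).indicator fun t => ENNReal.ofReal t⁻¹) (ENNReal.ofReal b)
      = ENNReal.ofReal (Real.posLog b) := by
  rw [primitiveBelow, setOf_ofReal_lt_ofReal, lintegral_indicator measurableSet_Ioi,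
    Measure.restrict_restrict measurableSet_Ioi]
  have e : Ioi (1 : ℝ) ∩ Ioo 0 b = Ioo 1 b := by
    ext t
    simp only [mem_inter_iff, mem_Ioi, mem_Ioo]
    constructor
    · rintro ⟨h1, -, h2⟩; exact ⟨h1, h2⟩
    · rintro ⟨h1, h2⟩; exact ⟨h1, by linarith, h2⟩
  rw [e]
  rcases le_total b 1 with h | h
  · rw [Ioo_eq_empty (by simpa using h), Measure.restrict_empty, lintegral_zero_measure,
      (Real.posLog_eq_zero_iff b).2 (by rwa [abs_of_nonneg hb]), ENNReal.ofReal_zero]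
  · rw [lintegral_Ioo_ofReal h, integral_inv_of_pos one_pos (by linarith), div_one,
      Real.posLog_eq_log (by rwa [abs_of_nonneg hb])]
    · exact intervalIntegral.intervalIntegrable_inv (fun t ht => by
        rw [uIcc_of_le h] at ht; linarith [ht.1]) continuousOn_id
    · intro t ht
      exact inv_nonneg.2 (by linarith [ht.1])

/-! ### Stopping cubes and maximal inequalities -/

section maximal

variable {n : ℕ} {Q₀ : Set (Fin n → ℝ)} {lev : ℕ → Set (Set (Fin n → ℝ))}

lemma dyadicMax_congr (h : IsDyadicGrid Q₀ lev) {g g' : (Fin n → ℝ) → ℝ≥0∞}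
    (hg : g =ᵐ[volume.restrict Q₀] g') : dyadicMax Q₀ g = dyadicMax Q₀ g' := by
  funext x
  refine iSup_congr fun Q => iSup_congr fun hQ => ?_
  rw [lintegral_congr_ae (ae_restrict_of_ae_restrict_of_subset (h.subset_root hQ) hg)]

lemma measurable_dyadicMax (h : IsDyadicGrid Q₀ lev) (g : (Fin n → ℝ) → ℝ≥0∞) :
    Measurable (dyadicMax Q₀ g) :=
  Measurable.biSup _ h.countable_dyadicSubcubes fun _ hQ =>
    measurable_const.indicator (isCube_of_mem_dyadicSubcubes hQ).measurableSet

/-- The maximal dyadic cubes on which the average of `g` exceeds `t`. -/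
def stoppingCubes (Q₀ : Set (Fin n → ℝ)) (g : (Fin n → ℝ) → ℝ≥0∞) (t : ℝ≥0∞) :
    Set (Set (Fin n → ℝ)) :=
  {Q | Maximal (fun R => R ∈ dyadicSubcubes Q₀ ∧ t < (∫⁻ y in R, g y) / volume R) Q}

lemma stoppingCubes_subset {g : (Fin n → ℝ) → ℝ≥0∞} {t : ℝ≥0∞} :
    stoppingCubes Q₀ g t ⊆ dyadicSubcubes Q₀ := fun _ hQ => hQ.1.1

lemma pairwiseDisjoint_stoppingCubes (h : IsDyadicGrid Q₀ lev) (g : (Fin n → ℝ) → ℝ≥0∞)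
    (t : ℝ≥0∞) : (stoppingCubes Q₀ g t).PairwiseDisjoint id :=
  h.pairwiseDisjoint_maximal fun _ hQ => hQ.1

lemma superlevel_dyadicMax (h : IsDyadicGrid Q₀ lev) (g : (Fin n → ℝ) → ℝ≥0∞) (t : ℝ≥0∞) :
    {x | t < dyadicMax Q₀ g x} = ⋃₀ stoppingCubes Q₀ g t := by
  ext x
  rw [mem_ofPred_eq, lt_dyadicMax_iff, mem_sUnion]
  constructor
  · rintro ⟨Q, hQ, hx, ht⟩
    obtain ⟨R, hR, hQR⟩ := h.exists_maximal
      (p := fun R => R ∈ dyadicSubcubes Q₀ ∧ t < (∫⁻ y in R, g y) / volume R)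
      (fun _ hQ => hQ.1) ⟨hQ, ht⟩
    exact ⟨R, hR, hQR hx⟩
  · rintro ⟨R, hR, hx⟩
    exact ⟨R, hR.1.1, hx, hR.1.2⟩

lemma IsDyadicGrid.volume_sUnion (h : IsDyadicGrid Q₀ lev) {F : Set (Set (Fin n → ℝ))}
    (hF : F ⊆ dyadicSubcubes Q₀) (hd : F.PairwiseDisjoint id) :
    volume (⋃₀ F) = ∑' Q : F, volume (Q : Set (Fin n → ℝ)) := by
  rw [sUnion_eq_biUnion]
  exact measure_biUnion (h.countable_dyadicSubcubes.mono hF) hd fun Q hQ =>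
    (isCube_of_mem_dyadicSubcubes (hF hQ)).measurableSet

lemma IsDyadicGrid.lintegral_sUnion (h : IsDyadicGrid Q₀ lev) {F : Set (Set (Fin n → ℝ))}
    (hF : F ⊆ dyadicSubcubes Q₀) (hd : F.PairwiseDisjoint id) (g : (Fin n → ℝ) → ℝ≥0∞) :
    ∫⁻ x in ⋃₀ F, g x = ∑' Q : F, ∫⁻ x in (Q : Set (Fin n → ℝ)), g x := by
  rw [sUnion_eq_biUnion]
  exact lintegral_biUnion (h.countable_dyadicSubcubes.mono hF) (fun Q hQ =>
    (isCube_of_mem_dyadicSubcubes (hF hQ)).measurableSet) hd _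

/-- The superlevel set is a disjoint union of stopping cubes, on each of which the average of `g`
exceeds `t`; hence weak type (1,1) with constant one. -/
lemma mul_volume_superlevel_le (h : IsDyadicGrid Q₀ lev) (g : (Fin n → ℝ) → ℝ≥0∞) (t : ℝ≥0∞) :
    t * volume {x | t < dyadicMax Q₀ g x} ≤ ∫⁻ x in {x | t < dyadicMax Q₀ g x}, g x := by
  have hd := pairwiseDisjoint_stoppingCubes h g t
  rw [superlevel_dyadicMax h, h.volume_sUnion stoppingCubes_subset hd,
    h.lintegral_sUnion stoppingCubes_subset hd, ← ENNReal.tsum_mul_left]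
  refine ENNReal.tsum_le_tsum fun Q => ?_
  have hc := isCube_of_mem_dyadicSubcubes (stoppingCubes_subset Q.2)
  exact (ENNReal.le_div_iff_mul_le (Or.inl hc.volume_ne_zero) (Or.inl hc.volume_ne_top)).1
    Q.2.1.2.le

/-- Reverse weak-type bound. By `ht` the root is not a stopping cube, so every stopping cube has a
parent in the grid. By maximality the average over the parent is at most `t`, and its volume is `2 ^
n` times larger. -/
lemma lintegral_superlevel_le (h : IsDyadicGrid Q₀ lev) {g : (Fin n → ℝ) → ℝ≥0∞} {t : ℝ≥0∞}
    (ht : (∫⁻ x in Q₀, g x) / volume Q₀ ≤ t) :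
    ∫⁻ x in {x | t < dyadicMax Q₀ g x}, g x
      ≤ 2 ^ n * t * volume {x | t < dyadicMax Q₀ g x} := by
  have hd := pairwiseDisjoint_stoppingCubes h g t
  rw [superlevel_dyadicMax h, h.volume_sUnion stoppingCubes_subset hd,
    h.lintegral_sUnion stoppingCubes_subset hd, ← ENNReal.tsum_mul_left]
  refine ENNReal.tsum_le_tsum fun ⟨Q, hQ⟩ => ?_
  have hQ₀ : Q ⊂ Q₀ := by
    refine (h.subset_root hQ.1.1).ssubset_of_ne ?_
    rintro rfl
    exact absurd hQ.1.2 (not_lt.2 ht)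
  obtain ⟨P, hP, hQP, -, hv⟩ := h.exists_parent h.mem_self hQ.1.1 hQ₀
  have hPt : (∫⁻ y in P, g y) / volume P ≤ t := by
    by_contra hlt
    exact hQP.2 (hQ.2 ⟨hP, not_le.1 hlt⟩ hQP.1)
  have hc := isCube_of_mem_dyadicSubcubes hP
  calc ∫⁻ x in Q, g x ≤ ∫⁻ x in P, g x := lintegral_mono_set hQP.1
    _ ≤ t * volume P :=
      (ENNReal.div_le_iff_le_mul (Or.inl hc.volume_ne_zero) (Or.inl hc.volume_ne_top)).1 hPt
    _ = 2 ^ n * t * volume Q := by rw [hv]; ring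

lemma superlevel_dyadicMax_subset (h : IsDyadicGrid Q₀ lev) (g : (Fin n → ℝ) → ℝ≥0∞)
    (t : ℝ≥0∞) : {x | t < dyadicMax Q₀ g x} ⊆ Q₀ := by
  intro x hx
  obtain ⟨Q, hQ, hxQ, -⟩ := lt_dyadicMax_iff.1 hx
  exact h.subset_root hQ hxQ

/-- The values of `g` not above `t` contribute at most `t` to any average. So where the maximal
function of `g` exceeds `2 * t`, that of `g` restricted to `t < g` exceeds `t`, and the weak-type
bound applies to the restriction. -/
lemma mul_volume_superlevel_two_mul_le (h : IsDyadicGrid Q₀ lev) {g : (Fin n → ℝ) → ℝ≥0∞}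
    (hg : Measurable g) (t : ℝ≥0∞) :
    t * volume {x | 2 * t < dyadicMax Q₀ g x} ≤ ∫⁻ x in {x | t < g x} ∩ Q₀, g x := by
  have hm : MeasurableSet {x | t < g x} := measurableSet_lt measurable_const hg
  set g' := {x | t < g x}.indicator g with hg'
  have hle : ∀ x, dyadicMax Q₀ g x ≤ dyadicMax Q₀ g' x + t := by
    intro x
    refine iSup₂_le fun Q hQ => ?_
    by_cases hx : x ∈ Q
    · rw [indicator_of_mem hx]
      have hc := isCube_of_mem_dyadicSubcubes hQ
      refine le_trans ?_ (add_le_add_left (average_le_dyadicMax g' hQ hx) t)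
      rw [ENNReal.div_le_iff_le_mul (Or.inl hc.volume_ne_zero) (Or.inl hc.volume_ne_top), add_mul,
        ENNReal.div_mul_cancel hc.volume_ne_zero hc.volume_ne_top, ← setLIntegral_const,
        ← lintegral_add_right _ measurable_const]
      refine lintegral_mono fun y => ?_
      by_cases hy : t < g y
      · rw [hg', indicator_of_mem (show y ∈ {x | t < g x} from hy)]
        exact le_self_add
      · exact (not_lt.1 hy).trans le_add_self
    · rw [indicator_of_notMem hx]
      exact zero_le
  have hsub : {x | 2 * t < dyadicMax Q₀ g x} ⊆ {x | t < dyadicMax Q₀ g' x} := by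
    intro x hx
    by_contra hx'
    refine absurd (hle x) (not_le.2 (lt_of_le_of_lt ?_ hx))
    rw [two_mul]
    exact add_le_add_left (not_lt.1 hx') t
  calc t * volume {x | 2 * t < dyadicMax Q₀ g x}
      ≤ t * volume {x | t < dyadicMax Q₀ g' x} := by gcongr
    _ ≤ ∫⁻ x in {x | t < dyadicMax Q₀ g' x}, g' x := mul_volume_superlevel_le h g' t
    _ ≤ ∫⁻ x in Q₀, g' x := lintegral_mono_set (superlevel_dyadicMax_subset h g' t)
    _ = ∫⁻ x in {x | t < g x} ∩ Q₀, g x := by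
      rw [hg', lintegral_indicator hm, Measure.restrict_restrict hm]

/-- The common source of the `L^p` and `L log L` bounds: the truncated weak-type inequality is
integrated against `φ`. The layer-cake formula is used on both sides, on the right for the measure
with density `g`. -/
lemma lintegral_primitiveBelow_dyadicMax_le (h : IsDyadicGrid Q₀ lev) {g : (Fin n → ℝ) → ℝ≥0∞}
    (hg : Measurable g) {φ : ℝ → ℝ≥0∞} (hφ : Measurable φ) :
    ∫⁻ x in Q₀, primitiveBelow φ (dyadicMax Q₀ g x)
      ≤ 2 * ∫⁻ x in Q₀, g x *
        primitiveBelow (fun t => φ t * ENNReal.ofReal t⁻¹) (2 * g x) := by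
  have hφ' : Measurable fun t => φ t * ENNReal.ofReal t⁻¹ :=
    hφ.mul (ENNReal.measurable_ofReal.comp measurable_inv)
  have hprim : Measurable (primitiveBelow fun t => φ t * ENNReal.ofReal t⁻¹) :=
    (primitiveBelow_mono _).measurable
  have h2g : Measurable fun x => 2 * g x := hg.const_mul 2
  have hwd : ∫⁻ x in Q₀, g x * primitiveBelow (fun t => φ t * ENNReal.ofReal t⁻¹) (2 * g x)
      = ∫⁻ x, primitiveBelow (fun t => φ t * ENNReal.ofReal t⁻¹) (2 * g x)
        ∂((volume.restrict Q₀).withDensity g) :=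
    (lintegral_withDensity_eq_lintegral_mul _ hg (hprim.comp h2g)).symm
  rw [hwd, lintegral_primitiveBelow _ (measurable_dyadicMax h g) hφ,
    lintegral_primitiveBelow _ h2g hφ', ← lintegral_const_mul' _ _ (by simp)]
  refine setLIntegral_mono' measurableSet_Ioi fun t (ht : 0 < t) => ?_
  have hm : MeasurableSet {x | ENNReal.ofReal t < 2 * g x} := measurableSet_lt measurable_const h2g
  have ht2 : ENNReal.ofReal t = 2 * ENNReal.ofReal (t / 2) := by
    rw [show (2 : ℝ≥0∞) = ENNReal.ofReal 2 by simp, ← ENNReal.ofReal_mul (by norm_num)]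
    congr 1; ring
  rw [withDensity_apply _ hm, Measure.restrict_restrict hm]
  have e : {x | ENNReal.ofReal t < 2 * g x} = {x | ENNReal.ofReal (t / 2) < g x} := by
    ext x
    rw [mem_ofPred_eq, mem_ofPred_eq, ht2,
      ENNReal.mul_lt_mul_iff_right (by simp) (by simp)]
  have key := mul_volume_superlevel_two_mul_le h hg (ENNReal.ofReal (t / 2))
  rw [← ht2] at key
  rw [e]
  calc φ t * (volume.restrict Q₀) {x | ENNReal.ofReal t < dyadicMax Q₀ g x}
      ≤ φ t * volume {x | ENNReal.ofReal t < dyadicMax Q₀ g x} := by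
        gcongr; exact Measure.restrict_le_self
    _ = φ t * (2 * ENNReal.ofReal t⁻¹ * (ENNReal.ofReal (t / 2) *
          volume {x | ENNReal.ofReal t < dyadicMax Q₀ g x})) := by
        rw [← mul_assoc (2 * ENNReal.ofReal t⁻¹), mul_right_comm 2, ← ht2,
          ← ENNReal.ofReal_mul ht.le, mul_inv_cancel₀ ht.ne', ENNReal.ofReal_one, one_mul]
    _ ≤ φ t * (2 * ENNReal.ofReal t⁻¹ *
          ∫⁻ x in {x | ENNReal.ofReal (t / 2) < g x} ∩ Q₀, g x) := by gcongr
    _ = _ := by ring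

/-- The `L^p` bound for the dyadic maximal function. -/
lemma lintegral_dyadicMax_rpow_le (h : IsDyadicGrid Q₀ lev) {p : ℝ} (hp : 1 < p)
    {g : (Fin n → ℝ) → ℝ≥0∞} (hg : AEMeasurable g (volume.restrict Q₀)) :
    ∫⁻ x in Q₀, dyadicMax Q₀ g x ^ p
      ≤ ENNReal.ofReal (p * 2 ^ p / (p - 1)) * ∫⁻ x in Q₀, g x ^ p := by
  wlog hgm : Measurable g generalizing g
  · have := this hg.measurable_mk.aemeasurable hg.measurable_mk
    rw [dyadicMax_congr h hg.ae_eq_mk]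
    refine this.trans (le_of_eq ?_)
    congr 1
    exact lintegral_congr_ae (hg.ae_eq_mk.mono fun x hx => by simp only [hx])
  have hp0 : 0 < p := by linarith
  have hp1 : 0 < p - 1 := by linarith
  -- For `φ t = t ^ (p - 1)` the primitive of `φ` is `a ^ p / p`, and that of `φ t / t` is `a ^ (p -
  -- 1) / (p - 1)`.
  have h1 := lintegral_primitiveBelow_dyadicMax_le h hgm
    (φ := fun t => ENNReal.ofReal (t ^ (p - 1))) (by fun_prop)
  have h2 : ∀ a, primitiveBelow (fun t => ENNReal.ofReal (t ^ (p - 1)) * ENNReal.ofReal t⁻¹) a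
      = a ^ (p - 1) / ENNReal.ofReal (p - 1) := by
    intro a
    have := primitiveBelow_rpow (r := p - 2) (by linarith) a
    rw [show p - 2 + 1 = p - 1 by ring] at this
    rw [← this]
    have hm : MeasurableSet {t : ℝ | 0 < t ∧ ENNReal.ofReal t < a} :=
      measurableSet_Ioi.inter (measurableSet_lt ENNReal.measurable_ofReal measurable_const)
    refine setLIntegral_congr_fun hm fun t ht => ?_
    have ht0 : 0 < t := ht.1
    rw [← ENNReal.ofReal_mul (by positivity), ← Real.rpow_neg_one t, ← Real.rpow_add ht0]
    congr 2; ring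
  simp_rw [h2, primitiveBelow_rpow (show -1 < p - 1 by linarith), sub_add_cancel,
    div_eq_mul_inv] at h1
  have hi : (ENNReal.ofReal p)⁻¹ ≠ ∞ := by simpa using hp0
  rw [lintegral_mul_const' _ _ hi] at h1
  have h3 : ∀ x, g x * ((2 * g x) ^ (p - 1) * (ENNReal.ofReal (p - 1))⁻¹)
      = ENNReal.ofReal (2 ^ (p - 1) / (p - 1)) * g x ^ p := by
    intro x
    rw [ENNReal.mul_rpow_of_nonneg _ _ hp1.le, ENNReal.ofReal_div_of_pos hp1,
      ← ENNReal.ofReal_rpow_of_pos (by norm_num), div_eq_mul_inv]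
    have : g x ^ p = g x * g x ^ (p - 1) := by
      conv_rhs => rw [← ENNReal.rpow_one (g x), ← ENNReal.rpow_mul, one_mul]
      rw [← ENNReal.rpow_add_of_nonneg _ _ zero_le_one hp1.le]
      congr 1; ring
    rw [this]
    simp only [ENNReal.ofReal_ofNat]
    ring
  simp_rw [h3] at h1
  rw [lintegral_const_mul' _ _ ENNReal.ofReal_ne_top, ← div_eq_mul_inv,
    ENNReal.div_le_iff_le_mul (Or.inl (by simpa using hp0)) (Or.inl ENNReal.ofReal_ne_top)] at h1
  refine h1.trans (le_of_eq ?_)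
  rw [← mul_assoc, mul_right_comm]
  congr 1
  rw [show (2 : ℝ≥0∞) = ENNReal.ofReal 2 by simp, ← ENNReal.ofReal_mul (by norm_num),
    ← ENNReal.ofReal_mul (by positivity), Real.rpow_sub_one (by norm_num)]
  congr 1
  field_simp

/-- Here `φ` is the indicator of `t > 1`, and integrating `φ t / t` up to `2 * G x` produces the
`posLog`. The levels `t ≤ 1` cost `volume Q₀`. -/
lemma lintegral_dyadicMax_le (h : IsDyadicGrid Q₀ lev) {G : (Fin n → ℝ) → ℝ}
    (hG : AEMeasurable G (volume.restrict Q₀)) (hG0 : ∀ x, 0 ≤ G x) :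
    ∫⁻ x in Q₀, dyadicMax Q₀ (fun y => ENNReal.ofReal (G y)) x
      ≤ volume Q₀ + 2 * ∫⁻ x in Q₀, ENNReal.ofReal (G x * Real.posLog (2 * G x)) := by
  wlog hGm : Measurable G generalizing G
  · have := this (G := fun x => max (hG.mk G x) 0)
      ((hG.measurable_mk.max measurable_const).aemeasurable) (fun x => le_max_right _ _)
      (hG.measurable_mk.max measurable_const)
    have hae : G =ᵐ[volume.restrict Q₀] fun x => max (hG.mk G x) 0 :=
      hG.ae_eq_mk.mono fun x hx => by simp only [← hx, max_eq_left (hG0 x)]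
    rw [dyadicMax_congr h (hae.mono fun x hx => congrArg ENNReal.ofReal hx)]
    refine this.trans (le_of_eq ?_)
    congr 2
    exact lintegral_congr_ae (hae.mono fun x hx => by simp only [hx])
  set g : (Fin n → ℝ) → ℝ≥0∞ := fun y => ENNReal.ofReal (G y) with hg
  have hgm : Measurable g := by fun_prop
  have h1 := lintegral_primitiveBelow_dyadicMax_le h hgm
    (φ := (Ioi 1).indicator 1) (measurable_one.indicator measurableSet_Ioi)
  have h2 : ∀ x, g x * primitiveBelow
      (fun t => (Ioi 1).indicator 1 t * ENNReal.ofReal t⁻¹) (2 * g x)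
      = ENNReal.ofReal (G x * Real.posLog (2 * G x)) := by
    intro x
    have e : (fun t : ℝ => (Ioi 1).indicator 1 t * ENNReal.ofReal t⁻¹)
        = (Ioi 1).indicator fun t => ENNReal.ofReal t⁻¹ := by
      ext t
      by_cases ht : t ∈ Ioi (1 : ℝ) <;> simp [ht]
    have e2 : 2 * g x = ENNReal.ofReal (2 * G x) := by
      rw [ENNReal.ofReal_mul (by norm_num)]; simp [hg]
    rw [e, e2, primitiveBelow_indicator_inv (by linarith [hG0 x]), hg,
      ← ENNReal.ofReal_mul (hG0 x)]
  simp_rw [h2] at h1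
  calc ∫⁻ x in Q₀, dyadicMax Q₀ g x
      ≤ ∫⁻ x in Q₀, (1 + primitiveBelow ((Ioi 1).indicator 1) (dyadicMax Q₀ g x)) :=
        lintegral_mono fun x => le_one_add_primitiveBelow _
    _ = volume Q₀ + ∫⁻ x in Q₀, primitiveBelow ((Ioi 1).indicator 1) (dyadicMax Q₀ g x) := by
        rw [lintegral_add_left measurable_const, setLIntegral_const, one_mul]
    _ ≤ _ := by gcongr

/-- Stein's converse of the `L log L` bound for the maximal function. -/
lemma lintegral_mul_posLog_le (h : IsDyadicGrid Q₀ lev) {G : (Fin n → ℝ) → ℝ}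
    (hG : AEMeasurable G (volume.restrict Q₀)) (hG0 : ∀ x, 0 ≤ G x)
    (havg : ∫⁻ x in Q₀, ENNReal.ofReal (G x) ≤ volume Q₀)
    (hle : ∀ᵐ x ∂volume.restrict Q₀,
      ENNReal.ofReal (G x) ≤ dyadicMax Q₀ (fun y => ENNReal.ofReal (G y)) x) :
    ∫⁻ x in Q₀, ENNReal.ofReal (G x * Real.posLog (G x))
      ≤ 2 ^ n * ∫⁻ x in Q₀, dyadicMax Q₀ (fun y => ENNReal.ofReal (G y)) x := by
  set g : (Fin n → ℝ) → ℝ≥0∞ := fun y => ENNReal.ofReal (G y) with hg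
  have hgm : AEMeasurable g (volume.restrict Q₀) := hG.ennreal_ofReal
  have hc := isCube_of_mem_dyadicSubcubes h.mem_self
  set φ : ℝ → ℝ≥0∞ := (Ioi 1).indicator fun t => ENNReal.ofReal t⁻¹ with hφ
  have hφm : Measurable φ := Measurable.indicator (by fun_prop) measurableSet_Ioi
  have hMm := measurable_dyadicMax h g
  calc ∫⁻ x in Q₀, ENNReal.ofReal (G x * Real.posLog (G x))
      = ∫⁻ x in Q₀, g x * primitiveBelow φ (g x) := by
        refine lintegral_congr fun x => ?_
        rw [hg, primitiveBelow_indicator_inv (hG0 x), ENNReal.ofReal_mul (hG0 x)]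
    -- Enlarging the argument to the maximal function turns the layers into its superlevel sets,
    -- where the reverse weak-type bound is available.
    _ ≤ ∫⁻ x in Q₀, g x * primitiveBelow φ (dyadicMax Q₀ g x) :=
        lintegral_mono_ae (hle.mono fun x hx => by gcongr; exact primitiveBelow_mono φ hx)
    _ = ∫⁻ x, primitiveBelow φ (dyadicMax Q₀ g x) ∂((volume.restrict Q₀).withDensity g) := by
        exact (lintegral_withDensity_eq_lintegral_mul₀ hgm
          ((primitiveBelow_mono φ).measurable.comp hMm).aemeasurable).symm
    _ = ∫⁻ t in Ioi 0, φ t * ((volume.restrict Q₀).withDensity g)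
          {x | ENNReal.ofReal t < dyadicMax Q₀ g x} := lintegral_primitiveBelow _ hMm hφm
    _ ≤ ∫⁻ t in Ioi 0, 2 ^ n * ((Ioi 1).indicator 1 t * (volume.restrict Q₀)
          {x | ENNReal.ofReal t < dyadicMax Q₀ g x}) := by
        refine setLIntegral_mono' measurableSet_Ioi fun t (ht : 0 < t) => ?_
        by_cases ht1 : t ∈ Ioi (1 : ℝ)
        · have hm : MeasurableSet {x | ENNReal.ofReal t < dyadicMax Q₀ g x} :=
            measurableSet_lt measurable_const hMm
          have hs := superlevel_dyadicMax_subset h g (ENNReal.ofReal t)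
          rw [hφ, indicator_of_mem ht1, indicator_of_mem ht1, withDensity_apply _ hm,
            Measure.restrict_restrict hm, Measure.restrict_apply hm, inter_eq_left.2 hs]
          -- By `havg` the average over the root is at most one, hence below every level `t > 1`.
          -- The factor `t` of the reverse bound then cancels `φ t = t⁻¹`.
          have hav : (∫⁻ x in Q₀, g x) / volume Q₀ ≤ ENNReal.ofReal t := by
            rw [ENNReal.div_le_iff_le_mul (Or.inl hc.volume_ne_zero) (Or.inl hc.volume_ne_top)]
            refine havg.trans (le_mul_of_one_le_left' ?_)
            rw [← ENNReal.ofReal_one]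
            exact ENNReal.ofReal_le_ofReal (le_of_lt ht1)
          have := lintegral_superlevel_le h hav
          calc _ ≤ ENNReal.ofReal t⁻¹ * _ := mul_le_mul_right this _
            _ = 2 ^ n * (ENNReal.ofReal t⁻¹ * ENNReal.ofReal t *
                volume {x | ENNReal.ofReal t < dyadicMax Q₀ g x}) := by ring
            _ = _ := by
              rw [← ENNReal.ofReal_mul (by positivity), inv_mul_cancel₀ ht.ne',
                ENNReal.ofReal_one, Pi.one_apply]
        · rw [hφ, indicator_of_notMem ht1, zero_mul]
          exact zero_le
    _ = 2 ^ n * ∫⁻ x in Q₀, primitiveBelow ((Ioi 1).indicator 1) (dyadicMax Q₀ g x) := by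
        rw [lintegral_const_mul' _ _ (by simp), lintegral_primitiveBelow _ hMm
          (measurable_one.indicator measurableSet_Ioi)]
    _ ≤ _ := by
        gcongr
        exact primitiveBelow_indicator_one_le _

end maximal

/-! ### Sparse families and duality -/

section sparse

variable {n : ℕ} {Q₀ : Set (Fin n → ℝ)} {lev : ℕ → Set (Set (Fin n → ℝ))}

lemma meanOsc_eq (f : (Fin n → ℝ) → ℝ) (Q : Set (Fin n → ℝ)) :
    meanOsc f Q = (∫⁻ x in Q, ‖f x - ⨍ y in Q, f y‖ₑ) / volume Q := setLAverage_eq _ _ _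

lemma enorm_setAverage_sub_le {f : (Fin n → ℝ) → ℝ} {Q : Set (Fin n → ℝ)} (hQ : IsCube Q)
    (hf : IntegrableOn f Q) (c : ℝ) :
    ‖(⨍ y in Q, f y) - c‖ₑ ≤ (∫⁻ x in Q, ‖f x - c‖ₑ) / volume Q := by
  have hv0 : 0 < volume.real Q := ENNReal.toReal_pos hQ.volume_ne_zero hQ.volume_ne_top
  have hci : IntegrableOn (fun _ => c) Q := integrableOn_const hQ.volume_ne_top
  have e : (⨍ y in Q, f y) - c = (volume.real Q)⁻¹ * ∫ y in Q, (f y - c) := by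
    rw [integral_sub hf hci, setAverage_eq, setIntegral_const, smul_eq_mul, smul_eq_mul]
    field_simp
  rw [e, enorm_mul, ENNReal.div_eq_inv_mul]
  gcongr
  · rw [Real.enorm_of_nonneg (by positivity), ENNReal.ofReal_inv_of_pos hv0, measureReal_def,
      ENNReal.ofReal_toReal hQ.volume_ne_top]
  · exact enorm_integral_le_lintegral_enorm _

lemma average_enorm_sub_le (f : (Fin n → ℝ) → ℝ) {Q : Set (Fin n → ℝ)} (hQ : IsCube Q)
    (c d : ℝ) : (∫⁻ x in Q, ‖f x - c‖ₑ) / volume Q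
      ≤ (∫⁻ x in Q, ‖f x - d‖ₑ) / volume Q + ‖d - c‖ₑ := by
  rw [ENNReal.div_le_iff_le_mul (Or.inl hQ.volume_ne_zero) (Or.inl hQ.volume_ne_top), add_mul,
    ENNReal.div_mul_cancel hQ.volume_ne_zero hQ.volume_ne_top, ← setLIntegral_const,
    ← lintegral_add_right _ measurable_const]
  refine lintegral_mono fun x => ?_
  rw [show f x - c = (f x - d) + (d - c) by ring]
  exact enorm_add_le _ _

lemma meanOsc_le {f : (Fin n → ℝ) → ℝ} {Q : Set (Fin n → ℝ)} (hQ : IsCube Q)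
    (hf : IntegrableOn f Q) (c : ℝ) :
    meanOsc f Q ≤ 2 * ((∫⁻ x in Q, ‖f x - c‖ₑ) / volume Q) := by
  rw [meanOsc_eq, two_mul]
  refine (average_enorm_sub_le f hQ _ c).trans ?_
  gcongr
  rw [enorm_sub_rev]
  exact enorm_setAverage_sub_le hQ hf c

lemma meanOsc_ne_top {f : (Fin n → ℝ) → ℝ} {Q : Set (Fin n → ℝ)} (hQ : IsCube Q)
    (hf : IntegrableOn f Q) : meanOsc f Q ≠ ∞ := by
  have := meanOsc_le hQ hf 0
  refine ne_top_of_le_ne_top ?_ this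
  simp only [sub_zero]
  exact ENNReal.mul_ne_top (by simp) (ENNReal.div_ne_top hf.2.ne hQ.volume_ne_zero)

/-- The part of `Q` which is not covered by its children in `S`. -/
def sparsePart (S : Set (Set (Fin n → ℝ))) (Q : Set (Fin n → ℝ)) : Set (Fin n → ℝ) :=
  Q \ ⋃₀ sparseChildren S Q

lemma sparseChildren_subset (S : Set (Set (Fin n → ℝ))) (Q : Set (Fin n → ℝ)) :
    sparseChildren S Q ⊆ S := fun _ hR => hR.1.1

lemma measurableSet_sparsePart (h : IsDyadicGrid Q₀ lev) {S : Set (Set (Fin n → ℝ))}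
    (hS : S ⊆ dyadicSubcubes Q₀) {Q : Set (Fin n → ℝ)} (hQ : Q ∈ S) :
    MeasurableSet (sparsePart S Q) := by
  refine (isCube_of_mem_dyadicSubcubes (hS hQ)).measurableSet.diff ?_
  have hsub := (sparseChildren_subset S Q).trans hS
  exact MeasurableSet.sUnion (h.countable_dyadicSubcubes.mono hsub) fun R hR =>
    (isCube_of_mem_dyadicSubcubes (hsub hR)).measurableSet

lemma not_ssubset_of_mem_sparsePart (h : IsDyadicGrid Q₀ lev) {S : Set (Set (Fin n → ℝ))}
    (hS : S ⊆ dyadicSubcubes Q₀) {Q R : Set (Fin n → ℝ)} (hR : R ∈ S)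
    {x : Fin n → ℝ} (hxQ : x ∈ sparsePart S Q) (hxR : x ∈ R) : ¬ R ⊂ Q := by
  intro hRQ
  obtain ⟨T, hT, hRT⟩ := h.exists_maximal (p := fun R => R ∈ S ∧ R ⊂ Q)
    (fun _ hp => hS hp.1) ⟨hR, hRQ⟩
  exact hxQ.2 ⟨T, hT, hRT hxR⟩

/-- Of two distinct cubes of `S` that meet, the smaller lies in a child of the larger, and children
are removed. Thus the sum defining `sparseOsc` has at most one nonzero term at each point. -/
lemma eq_of_mem_sparsePart (h : IsDyadicGrid Q₀ lev) {S : Set (Set (Fin n → ℝ))}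
    (hS : S ⊆ dyadicSubcubes Q₀) {Q R : Set (Fin n → ℝ)} (hQ : Q ∈ S) (hR : R ∈ S)
    {x : Fin n → ℝ} (hxQ : x ∈ sparsePart S Q) (hxR : x ∈ sparsePart S R) : Q = R := by
  rcases h.subset_or_subset (hS hQ) (hS hR) ⟨x, hxQ.1, hxR.1⟩ with hs | hs
  · by_contra hne
    exact not_ssubset_of_mem_sparsePart h hS hQ hxR hxQ.1 (hs.ssubset_of_ne hne)
  · by_contra hne
    exact not_ssubset_of_mem_sparsePart h hS hR hxQ hxR.1 (hs.ssubset_of_ne (Ne.symm hne))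

lemma sparseOsc_eq (f : (Fin n → ℝ) → ℝ) (S : Set (Set (Fin n → ℝ))) (x : Fin n → ℝ) :
    sparseOsc f S x = ∑' Q : S, (sparsePart S Q).indicator (fun _ => meanOsc f Q) x := rfl

lemma sparseOsc_le (h : IsDyadicGrid Q₀ lev) {S : Set (Set (Fin n → ℝ))}
    (hS : S ⊆ dyadicSubcubes Q₀) (f : (Fin n → ℝ) → ℝ) {x : Fin n → ℝ} {b : ℝ≥0∞}
    (hb : ∀ Q ∈ S, x ∈ Q → meanOsc f Q ≤ b) : sparseOsc f S x ≤ b := by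
  rw [sparseOsc_eq]
  by_cases hex : ∃ Q : S, x ∈ sparsePart S Q
  · obtain ⟨Q, hxQ⟩ := hex
    rw [tsum_eq_single Q, indicator_of_mem hxQ]
    · exact hb Q Q.2 hxQ.1
    · intro R hne
      refine indicator_of_notMem (fun hxR => hne ?_) _
      exact Subtype.ext (eq_of_mem_sparsePart h hS R.2 Q.2 hxR hxQ)
  · have : ∀ Q : S, (sparsePart S Q).indicator (fun _ => meanOsc f Q) x = 0 := fun Q =>
      indicator_of_notMem (fun hxQ => hex ⟨Q, hxQ⟩) _
    simp [this]

lemma sparseOsc_le_dyadicMax (h : IsDyadicGrid Q₀ lev) {S : Set (Set (Fin n → ℝ))}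
    (hS : S ⊆ dyadicSubcubes Q₀) {f : (Fin n → ℝ) → ℝ} (hf : IntegrableOn f Q₀) (c : ℝ)
    (x : Fin n → ℝ) : sparseOsc f S x ≤ 2 * dyadicMax Q₀ (fun y => ‖f y - c‖ₑ) x := by
  refine sparseOsc_le h hS f fun Q hQ hx => ?_
  refine (meanOsc_le (isCube_of_mem_dyadicSubcubes (hS hQ))
    (hf.mono_set (h.subset_root (hS hQ))) c).trans ?_
  gcongr
  exact average_le_dyadicMax (fun y => ‖f y - c‖ₑ) (hS hQ) hx

lemma measurable_sparseOsc (h : IsDyadicGrid Q₀ lev) {S : Set (Set (Fin n → ℝ))}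
    (hS : S ⊆ dyadicSubcubes Q₀) (f : (Fin n → ℝ) → ℝ) : Measurable (sparseOsc f S) := by
  have : Countable S := (h.countable_dyadicSubcubes.mono hS).to_subtype
  exact Measurable.tsum fun Q =>
    measurable_const.indicator (measurableSet_sparsePart h hS Q.2)

/-- The children are disjoint and fill at most half of `Q`. This is the only place where the
numerical bound in the definition of sparseness is used. -/
lemma volume_le_two_mul_sparsePart (h : IsDyadicGrid Q₀ lev) {S : Set (Set (Fin n → ℝ))}
    (hS : IsSparseFamily Q₀ S) {Q : Set (Fin n → ℝ)} (hQ : Q ∈ S) :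
    volume Q ≤ 2 * volume (sparsePart S Q) := by
  have hsub := (sparseChildren_subset S Q).trans hS.1
  have hd : (sparseChildren S Q).PairwiseDisjoint id :=
    h.pairwiseDisjoint_maximal fun _ hp => hS.1 hp.1
  have h1 : volume (⋃₀ sparseChildren S Q) ≤ volume Q / 2 := by
    rw [h.volume_sUnion hsub hd]; exact hS.2 Q hQ
  have h2 : volume Q ≤ volume (sparsePart S Q) + volume Q / 2 :=
    calc volume Q ≤ volume (sparsePart S Q ∪ ⋃₀ sparseChildren S Q) := by
          refine measure_mono fun x hx => ?_
          by_cases hx' : x ∈ ⋃₀ sparseChildren S Q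
          · exact Or.inr hx'
          · exact Or.inl ⟨hx, hx'⟩
      _ ≤ _ := (measure_union_le _ _).trans (by gcongr)
  have hfin : volume Q / 2 ≠ ∞ :=
    ENNReal.div_ne_top (isCube_of_mem_dyadicSubcubes (hS.1 hQ)).volume_ne_top (by simp)
  have h3 : volume Q / 2 ≤ volume (sparsePart S Q) := by
    rw [← ENNReal.add_le_add_iff_right hfin]
    rwa [ENNReal.add_halves]
  calc volume Q = 2 * (volume Q / 2) := by rw [ENNReal.mul_div_cancel (by simp) (by simp)]
    _ ≤ _ := by gcongr

/-- The sum of the mean oscillations over the full cubes of `S`. -/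
def fullOsc (f : (Fin n → ℝ) → ℝ) (S : Set (Set (Fin n → ℝ))) (x : Fin n → ℝ) : ℝ≥0∞ :=
  ∑' Q : S, (Q : Set (Fin n → ℝ)).indicator (fun _ => meanOsc f Q) x

lemma measurable_fullOsc (h : IsDyadicGrid Q₀ lev) {S : Set (Set (Fin n → ℝ))}
    (hS : S ⊆ dyadicSubcubes Q₀) (f : (Fin n → ℝ) → ℝ) : Measurable (fullOsc f S) := by
  have : Countable S := (h.countable_dyadicSubcubes.mono hS).to_subtype
  exact Measurable.tsum fun Q =>
    measurable_const.indicator (isCube_of_mem_dyadicSubcubes (hS Q.2)).measurableSet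

/-- Cube by cube: `∫_Q ψ` is the average of `ψ` times `|Q|`, hence at most twice that average times
the measure of the sparse part. On the sparse part the average is below the maximal function of `ψ`.
-/
lemma lintegral_fullOsc_mul_le (h : IsDyadicGrid Q₀ lev) {S : Set (Set (Fin n → ℝ))}
    (hS : IsSparseFamily Q₀ S) (f : (Fin n → ℝ) → ℝ) {ψ : (Fin n → ℝ) → ℝ≥0∞}
    (hψ : Measurable ψ) :
    ∫⁻ x in Q₀, fullOsc f S x * ψ x
      ≤ 2 * ∫⁻ x in Q₀, sparseOsc f S x * dyadicMax Q₀ ψ x := by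
  have : Countable S := (h.countable_dyadicSubcubes.mono hS.1).to_subtype
  have hMm := measurable_dyadicMax h ψ
  have hc : ∀ Q : S, IsCube (Q : Set (Fin n → ℝ)) := fun Q =>
    isCube_of_mem_dyadicSubcubes (hS.1 Q.2)
  have key : ∀ (A : S → Set (Fin n → ℝ)), (∀ Q, MeasurableSet (A Q)) → (∀ Q, A Q ⊆ Q₀) →
      ∀ θ : (Fin n → ℝ) → ℝ≥0∞, Measurable θ →
      ∫⁻ x in Q₀, (∑' Q : S, (A Q).indicator (fun _ => meanOsc f Q) x) * θ x
        = ∑' Q : S, meanOsc f Q * ∫⁻ x in A Q, θ x := by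
    intro A hA hAQ θ hθ
    simp_rw [← ENNReal.tsum_mul_right]
    rw [lintegral_tsum]
    swap
    · exact fun Q => ((measurable_const.indicator (hA Q)).mul hθ).aemeasurable
    refine tsum_congr fun Q => ?_
    have e : ∀ x, (A Q).indicator (fun _ => meanOsc f Q) x * θ x
        = (A Q).indicator (fun x => meanOsc f Q * θ x) x := by
      intro x
      by_cases hx : x ∈ A Q <;> simp [hx]
    simp_rw [e]
    rw [lintegral_indicator (hA Q), Measure.restrict_restrict (hA Q),
      inter_eq_left.2 (hAQ Q), lintegral_const_mul _ hθ]
  simp_rw [fullOsc, sparseOsc_eq]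
  rw [key (fun Q => Q) (fun Q => (hc Q).measurableSet) (fun Q => h.subset_root (hS.1 Q.2)) ψ hψ,
    key (fun Q => sparsePart S Q) (fun Q => measurableSet_sparsePart h hS.1 Q.2)
      (fun Q => sdiff_subset.trans (h.subset_root (hS.1 Q.2))) _ hMm, ← ENNReal.tsum_mul_left]
  refine ENNReal.tsum_le_tsum fun Q => ?_
  rw [mul_left_comm]
  gcongr
  calc ∫⁻ x in (Q : Set (Fin n → ℝ)), ψ x
      = (∫⁻ x in (Q : Set (Fin n → ℝ)), ψ x) / volume (Q : Set (Fin n → ℝ)) *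
          volume (Q : Set (Fin n → ℝ)) :=
        (ENNReal.div_mul_cancel (hc Q).volume_ne_zero (hc Q).volume_ne_top).symm
    _ ≤ (∫⁻ x in (Q : Set (Fin n → ℝ)), ψ x) / volume (Q : Set (Fin n → ℝ)) *
          (2 * volume (sparsePart S Q)) := by
        gcongr; exact volume_le_two_mul_sparsePart h hS Q.2
    _ = 2 * ∫⁻ _ in sparsePart S Q,
          (∫⁻ x in (Q : Set (Fin n → ℝ)), ψ x) / volume (Q : Set (Fin n → ℝ)) := by
        rw [setLIntegral_const]; ring
    _ ≤ 2 * ∫⁻ x in sparsePart S Q, dyadicMax Q₀ ψ x := by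
        gcongr 2 * ?_
        exact setLIntegral_mono' (measurableSet_sparsePart h hS.1 Q.2) fun x hx =>
          average_le_dyadicMax ψ (hS.1 Q.2) hx.1

lemma lintegral_fullOsc_le (h : IsDyadicGrid Q₀ lev) {S : Set (Set (Fin n → ℝ))}
    (hS : IsSparseFamily Q₀ S) (f : (Fin n → ℝ) → ℝ) :
    ∫⁻ x in Q₀, fullOsc f S x ≤ 2 * ∫⁻ x in Q₀, sparseOsc f S x := by
  have h1 := lintegral_fullOsc_mul_le h hS f (ψ := fun _ => 1) measurable_const
  simp only [mul_one] at h1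
  refine h1.trans ?_
  gcongr 2 * ?_
  refine lintegral_mono fun x => mul_le_of_le_one_right' (iSup₂_le fun Q hQ => ?_)
  by_cases hx : x ∈ Q
  · rw [indicator_of_mem hx, setLIntegral_const, one_mul]
    exact ENNReal.div_self_le_one
  · rw [indicator_of_notMem hx]
    exact zero_le

/-- The absorption step of the duality argument; `A` must be finite for the factor `A ^ (1 / q)` to
be cancelled. -/
lemma rpow_le_of_le_mul_rpow {A B : ℝ≥0∞} {p q : ℝ} (hpq : p.HolderConjugate q) (hA : A ≠ ∞)
    (h : A ≤ B * A ^ (1 / q)) : A ≤ B ^ p := by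
  rcases eq_or_ne A 0 with rfl | hA0
  · exact zero_le
  have hp := hpq.pos
  have hq := hpq.symm.pos
  have e : A = A ^ (1 / p) * A ^ (1 / q) := by
    rw [← ENNReal.rpow_add _ _ hA0 hA, one_div, one_div, hpq.inv_add_inv_eq_one, ENNReal.rpow_one]
  have h0 : A ^ (1 / q) ≠ 0 := by
    simp [ENNReal.rpow_eq_zero_iff, hA0, hA]
  have ht : A ^ (1 / q) ≠ ∞ := ENNReal.rpow_ne_top_of_nonneg (by positivity) hA
  have h1 : A ^ (1 / p) ≤ B := by
    rw [← ENNReal.mul_le_mul_iff_left h0 ht, ← e]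
    exact h
  calc A = (A ^ (1 / p)) ^ p := by
        rw [← ENNReal.rpow_mul, one_div_mul_cancel hp.ne', ENNReal.rpow_one]
    _ ≤ B ^ p := ENNReal.rpow_le_rpow h1 hp.le

/-- The duality inequality is tested on `fullOsc ^ (p - 1)`. Hölder and the maximal theorem in
`L^q`, with `(p - 1) * q = p`, bring back the left-hand integral to the power `1 / q`, which is
absorbed. -/
lemma lintegral_fullOsc_rpow_le (h : IsDyadicGrid Q₀ lev) {S : Set (Set (Fin n → ℝ))}
    (hS : IsSparseFamily Q₀ S) (f : (Fin n → ℝ) → ℝ) {p q : ℝ} (hpq : p.HolderConjugate q) :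
    (∫⁻ x in Q₀, fullOsc f S x ^ p) ^ (1 / p)
      ≤ 2 * ENNReal.ofReal (q * 2 ^ q / (q - 1)) ^ (1 / q) *
        (∫⁻ x in Q₀, sparseOsc f S x ^ p) ^ (1 / p) := by
  have hp := hpq.pos
  have hq := hpq.symm.pos
  have hp1 : 0 < p - 1 := hpq.sub_one_pos
  have hc := isCube_of_mem_dyadicSubcubes h.mem_self
  have hFm := measurable_fullOsc h hS.1 f
  set F := fullOsc f S with hF
  set K : ℝ≥0∞ := ENNReal.ofReal (q * 2 ^ q / (q - 1)) with hK
  set B := 2 * K ^ (1 / q) * (∫⁻ x in Q₀, sparseOsc f S x ^ p) ^ (1 / p) with hB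
  -- Truncation at `N` keeps the integral to be absorbed finite; monotone convergence removes it
  -- afterwards.
  have hmain : ∀ N : ℕ, ∫⁻ x in Q₀, min (F x) N ^ p ≤ B ^ p := by
    intro N
    have hmm : Measurable fun x => min (F x) (N : ℝ≥0∞) := hFm.min measurable_const
    have hψm : Measurable fun x => min (F x) (N : ℝ≥0∞) ^ (p - 1) := hmm.pow_const _
    refine rpow_le_of_le_mul_rpow hpq ?_ ?_
    · have : ∫⁻ x in Q₀, min (F x) (N : ℝ≥0∞) ^ p ≤ ∫⁻ _ in Q₀, (N : ℝ≥0∞) ^ p :=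
        lintegral_mono fun x => ENNReal.rpow_le_rpow (min_le_right _ _) hp.le
      refine ne_top_of_le_ne_top ?_ this
      rw [setLIntegral_const]
      exact ENNReal.mul_ne_top (ENNReal.rpow_ne_top_of_nonneg hp.le (by simp)) hc.volume_ne_top
    · calc ∫⁻ x in Q₀, min (F x) (N : ℝ≥0∞) ^ p
          ≤ ∫⁻ x in Q₀, F x * min (F x) (N : ℝ≥0∞) ^ (p - 1) := by
            refine lintegral_mono fun x => ?_
            have : min (F x) (N : ℝ≥0∞) ^ p
                = min (F x) (N : ℝ≥0∞) * min (F x) (N : ℝ≥0∞) ^ (p - 1) := by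
              conv_rhs => enter [1]; rw [← ENNReal.rpow_one (min (F x) (N : ℝ≥0∞))]
              rw [← ENNReal.rpow_add_of_nonneg _ _ zero_le_one hp1.le]
              congr 1; ring
            rw [this]
            gcongr
            exact min_le_left _ _
        _ ≤ 2 * ∫⁻ x in Q₀, sparseOsc f S x *
              dyadicMax Q₀ (fun x => min (F x) (N : ℝ≥0∞) ^ (p - 1)) x :=
            lintegral_fullOsc_mul_le h hS f hψm
        _ ≤ 2 * ((∫⁻ x in Q₀, sparseOsc f S x ^ p) ^ (1 / p) *
              (∫⁻ x in Q₀, dyadicMax Q₀ (fun x => min (F x) (N : ℝ≥0∞) ^ (p - 1)) x ^ q)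
                ^ (1 / q)) := by
            gcongr 2 * ?_
            exact ENNReal.lintegral_mul_le_Lp_mul_Lq _ hpq
              (measurable_sparseOsc h hS.1 f).aemeasurable
              (measurable_dyadicMax h _).aemeasurable
        _ ≤ 2 * ((∫⁻ x in Q₀, sparseOsc f S x ^ p) ^ (1 / p) *
              (K * ∫⁻ x in Q₀, min (F x) (N : ℝ≥0∞) ^ p) ^ (1 / q)) := by
            gcongr 2 * (_ * ?_ ^ (1 / q))
            refine (lintegral_dyadicMax_rpow_le h hpq.symm.lt hψm.aemeasurable).trans
              (le_of_eq ?_)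
            congr 1
            refine lintegral_congr fun x => ?_
            rw [← ENNReal.rpow_mul, hpq.sub_one_mul_conj]
        _ = B * _ := by
            rw [ENNReal.mul_rpow_of_nonneg _ _ (by positivity), hB]
            ring
  have hlim : ∫⁻ x in Q₀, F x ^ p ≤ B ^ p := by
    have ht : Filter.Tendsto (fun N : ℕ => ∫⁻ x in Q₀, min (F x) (N : ℝ≥0∞) ^ p) Filter.atTop
        (nhds (∫⁻ x in Q₀, F x ^ p)) := by
      refine lintegral_tendsto_of_tendsto_of_monotone
        (fun N => ((hFm.min measurable_const).pow_const _).aemeasurable)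
        (Filter.Eventually.of_forall fun x N M hNM => ?_)
        (Filter.Eventually.of_forall fun x => ?_)
      · exact ENNReal.rpow_le_rpow (min_le_min_left _ (by exact_mod_cast hNM)) hp.le
      · have h1 : Filter.Tendsto (fun N : ℕ => min (F x) (N : ℝ≥0∞)) Filter.atTop
            (nhds (F x)) := by
          simpa using tendsto_const_nhds.min ENNReal.tendsto_nat_nhds_top
        exact (ENNReal.continuous_rpow_const.tendsto _).comp h1
    exact le_of_tendsto' ht hmain
  calc (∫⁻ x in Q₀, F x ^ p) ^ (1 / p) ≤ (B ^ p) ^ (1 / p) :=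
        ENNReal.rpow_le_rpow hlim (by positivity)
    _ = B := by rw [← ENNReal.rpow_mul, mul_one_div_cancel hp.ne', ENNReal.rpow_one]

end sparse

/-! ### The stopping family and pointwise domination -/

section construction

variable {n : ℕ} {Q₀ : Set (Fin n → ℝ)} {lev : ℕ → Set (Set (Fin n → ℝ))}

/-- The maximal dyadic subcubes of `Q` on which the average of `|f - f_Q|` is more than twice the
mean oscillation of `f` over `Q`. -/
def oscStops (Q₀ : Set (Fin n → ℝ)) (f : (Fin n → ℝ) → ℝ) (Q : Set (Fin n → ℝ)) :
    Set (Set (Fin n → ℝ)) :=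
  {R | Maximal (fun R => R ∈ dyadicSubcubes Q₀ ∧ R ⊆ Q ∧
    2 * meanOsc f Q < (∫⁻ x in R, ‖f x - ⨍ y in Q, f y‖ₑ) / volume R) R}

/-- The generations of the stopping family of `f`. -/
def oscGeneration (Q₀ : Set (Fin n → ℝ)) (f : (Fin n → ℝ) → ℝ) : ℕ → Set (Set (Fin n → ℝ))
  | 0 => {Q₀}
  | k + 1 => {R | ∃ Q ∈ oscGeneration Q₀ f k, R ∈ oscStops Q₀ f Q}

/-- The stopping family of `f`. -/
def oscFamily (Q₀ : Set (Fin n → ℝ)) (f : (Fin n → ℝ) → ℝ) : Set (Set (Fin n → ℝ)) :=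
  {Q | ∃ k, Q ∈ oscGeneration Q₀ f k}

lemma oscStops_subset (f : (Fin n → ℝ) → ℝ) (Q : Set (Fin n → ℝ)) :
    oscStops Q₀ f Q ⊆ dyadicSubcubes Q₀ := fun _ hR => hR.1.1

lemma pairwiseDisjoint_oscStops (h : IsDyadicGrid Q₀ lev) (f : (Fin n → ℝ) → ℝ)
    (Q : Set (Fin n → ℝ)) : (oscStops Q₀ f Q).PairwiseDisjoint id :=
  h.pairwiseDisjoint_maximal fun _ hp => hp.1

/-- `Q` does not select itself: its own average of `|f - f_Q|` is the mean oscillation, which cannot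
exceed its double. -/
lemma ssubset_of_mem_oscStops {f : (Fin n → ℝ) → ℝ} {Q R : Set (Fin n → ℝ)}
    (hR : R ∈ oscStops Q₀ f Q) : R ⊂ Q := by
  refine hR.1.2.1.ssubset_of_ne ?_
  rintro rfl
  have := hR.1.2.2
  rw [← meanOsc_eq] at this
  exact absurd this (not_lt.2 (le_mul_of_one_le_left' (by norm_num)))

lemma oscGeneration_subset (h : IsDyadicGrid Q₀ lev) (f : (Fin n → ℝ) → ℝ) (k : ℕ) :
    oscGeneration Q₀ f k ⊆ dyadicSubcubes Q₀ := by
  cases k with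
  | zero => rintro Q rfl; exact h.mem_self
  | succ k => rintro R ⟨Q, -, hR⟩; exact oscStops_subset f Q hR

lemma oscFamily_subset (h : IsDyadicGrid Q₀ lev) (f : (Fin n → ℝ) → ℝ) :
    oscFamily Q₀ f ⊆ dyadicSubcubes Q₀ := by
  rintro Q ⟨k, hk⟩
  exact oscGeneration_subset h f k hk

lemma eq_of_mem_oscGeneration (h : IsDyadicGrid Q₀ lev) {f : (Fin n → ℝ) → ℝ} {k : ℕ}
    {Q R : Set (Fin n → ℝ)} (hQ : Q ∈ oscGeneration Q₀ f k) (hR : R ∈ oscGeneration Q₀ f k)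
    (hne : (Q ∩ R).Nonempty) : Q = R := by
  induction k generalizing Q R with
  | zero => exact hQ.trans hR.symm
  | succ k ih =>
    obtain ⟨P, hP, hQP⟩ := hQ
    obtain ⟨T, hT, hRT⟩ := hR
    obtain rfl := ih hP hT (hne.mono (inter_subset_inter hQP.1.2.1 hRT.1.2.1))
    by_contra hQR
    exact not_disjoint_iff_nonempty_inter.2 hne (pairwiseDisjoint_oscStops h f P hQP hRT hQR)

lemma exists_subset_oscGeneration {f : (Fin n → ℝ) → ℝ} {j k : ℕ} (hjk : j ≤ k)
    {R : Set (Fin n → ℝ)} (hR : R ∈ oscGeneration Q₀ f k) :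
    ∃ Q ∈ oscGeneration Q₀ f j, R ⊆ Q := by
  induction k, hjk using Nat.le_induction generalizing R with
  | base => exact ⟨R, hR, subset_rfl⟩
  | succ k _ ih =>
    obtain ⟨P, hP, hRP⟩ := hR
    obtain ⟨Q, hQ, hPQ⟩ := ih hP
    exact ⟨Q, hQ, hRP.1.2.1.trans hPQ⟩

/-- Distinct cubes of one generation are disjoint, so a member inside `Q` comes from a later
generation and descends from `Q`. It follows that the children of `Q` in the family are covered by
`oscStops Q₀ f Q`. -/
lemma exists_mem_oscStops_of_ssubset (h : IsDyadicGrid Q₀ lev) {f : (Fin n → ℝ) → ℝ}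
    {Q R : Set (Fin n → ℝ)} (hQ : Q ∈ oscFamily Q₀ f) (hR : R ∈ oscFamily Q₀ f) (hRQ : R ⊂ Q) :
    ∃ T ∈ oscStops Q₀ f Q, R ⊆ T := by
  obtain ⟨x, hx⟩ := h.nonempty (oscFamily_subset h f hR)
  obtain ⟨j, hj⟩ := hQ
  obtain ⟨k, hk⟩ := hR
  rcases lt_or_ge j k with hjk | hjk
  · obtain ⟨T, ⟨P, hP, hTP⟩, hRT⟩ := exists_subset_oscGeneration (Nat.succ_le_of_lt hjk) hk
    obtain rfl := eq_of_mem_oscGeneration h hj hP ⟨x, hRQ.1 hx, hTP.1.2.1 (hRT hx)⟩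
    exact ⟨T, hTP, hRT⟩
  · obtain ⟨P, hP, hQP⟩ := exists_subset_oscGeneration hjk hj
    obtain rfl := eq_of_mem_oscGeneration h hk hP ⟨x, hx, hQP (hRQ.1 hx)⟩
    exact absurd hQP hRQ.2

lemma volume_sUnion_oscStops_le (h : IsDyadicGrid Q₀ lev) {f : (Fin n → ℝ) → ℝ}
    (hf : IntegrableOn f Q₀) {Q : Set (Fin n → ℝ)} (hQ : Q ∈ dyadicSubcubes Q₀) :
    volume (⋃₀ oscStops Q₀ f Q) ≤ volume Q / 2 := by
  have hc := isCube_of_mem_dyadicSubcubes hQ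
  have hm := meanOsc_ne_top hc (hf.mono_set (h.subset_root hQ))
  have hI : ∫⁻ x in Q, ‖f x - ⨍ y in Q, f y‖ₑ = meanOsc f Q * volume Q := by
    rw [meanOsc_eq, ENNReal.div_mul_cancel hc.volume_ne_zero hc.volume_ne_top]
  -- Chebyshev bounds the selected measure by half of `|Q|` after division by the mean oscillation.
  -- If that vanishes, no cube is selected.
  rcases eq_or_ne (meanOsc f Q) 0 with h0 | h0
  · have : oscStops Q₀ f Q = ∅ := by
      refine eq_empty_of_forall_notMem fun R hR => ?_
      have h1 := hR.1.2.2
      have h2 : ∫⁻ x in R, ‖f x - ⨍ y in Q, f y‖ₑ = 0 := by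
        refine le_antisymm ((lintegral_mono_set hR.1.2.1).trans ?_) zero_le
        rw [hI, h0, zero_mul]
      rw [h2, ENNReal.zero_div] at h1
      exact not_lt_zero h1
    simp [this]
  · have hd := pairwiseDisjoint_oscStops h f Q
    have h1 : 2 * meanOsc f Q * volume (⋃₀ oscStops Q₀ f Q) ≤ meanOsc f Q * volume Q := by
      calc 2 * meanOsc f Q * volume (⋃₀ oscStops Q₀ f Q)
          ≤ ∫⁻ x in ⋃₀ oscStops Q₀ f Q, ‖f x - ⨍ y in Q, f y‖ₑ := by
            rw [h.volume_sUnion (oscStops_subset f Q) hd,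
              h.lintegral_sUnion (oscStops_subset f Q) hd, ← ENNReal.tsum_mul_left]
            refine ENNReal.tsum_le_tsum fun R => ?_
            have hcR := isCube_of_mem_dyadicSubcubes (oscStops_subset f Q R.2)
            exact (ENNReal.le_div_iff_mul_le (Or.inl hcR.volume_ne_zero)
              (Or.inl hcR.volume_ne_top)).1 R.2.1.2.2.le
        _ ≤ ∫⁻ x in Q, ‖f x - ⨍ y in Q, f y‖ₑ :=
            lintegral_mono_set (sUnion_subset fun R hR => hR.1.2.1)
        _ = _ := hI
    rw [mul_comm 2, mul_assoc, ENNReal.mul_le_mul_iff_right h0 hm] at h1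
    rwa [ENNReal.le_div_iff_mul_le (by simp) (by simp), mul_comm]

lemma isSparseFamily_oscFamily (h : IsDyadicGrid Q₀ lev) {f : (Fin n → ℝ) → ℝ}
    (hf : IntegrableOn f Q₀) : IsSparseFamily Q₀ (oscFamily Q₀ f) := by
  refine ⟨oscFamily_subset h f, fun Q hQ => ?_⟩
  have hsub := (sparseChildren_subset (oscFamily Q₀ f) Q).trans (oscFamily_subset h f)
  have hd : (sparseChildren (oscFamily Q₀ f) Q).PairwiseDisjoint id :=
    h.pairwiseDisjoint_maximal fun _ hp => oscFamily_subset h f hp.1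
  rw [← h.volume_sUnion hsub hd]
  refine (measure_mono (sUnion_subset fun R hR => ?_)).trans
    (volume_sUnion_oscStops_le h hf (oscFamily_subset h f hQ))
  obtain ⟨T, hT, hRT⟩ := exists_mem_oscStops_of_ssubset h hQ hR.1.1 hR.1.2
  exact hRT.trans (subset_sUnion_of_mem hT)

/-- By maximality the dyadic parent of `R` is not selected, so its average of `|f - f_Q|` is at most
`2 * meanOsc f Q`. Passing from the parent to `R` costs `2 ^ n`. -/
lemma enorm_average_sub_le_of_mem_oscStops (h : IsDyadicGrid Q₀ lev) {f : (Fin n → ℝ) → ℝ}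
    (hf : IntegrableOn f Q₀) {Q R : Set (Fin n → ℝ)} (hQ : Q ∈ dyadicSubcubes Q₀)
    (hR : R ∈ oscStops Q₀ f Q) :
    ‖(⨍ y in R, f y) - ⨍ y in Q, f y‖ₑ ≤ 2 ^ (n + 1) * meanOsc f Q := by
  have hRD := oscStops_subset f Q hR
  obtain ⟨P, hP, hRP, hPQ, hv⟩ := h.exists_parent hQ hRD (ssubset_of_mem_oscStops hR)
  have hcR := isCube_of_mem_dyadicSubcubes hRD
  have hcP := isCube_of_mem_dyadicSubcubes hP
  have hPle : (∫⁻ x in P, ‖f x - ⨍ y in Q, f y‖ₑ) / volume P ≤ 2 * meanOsc f Q := by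
    by_contra hlt
    exact hRP.2 (hR.2 ⟨hP, hPQ, not_le.1 hlt⟩ hRP.1)
  refine (enorm_setAverage_sub_le hcR (hf.mono_set (h.subset_root hRD)) _).trans ?_
  rw [ENNReal.div_le_iff_le_mul (Or.inl hcP.volume_ne_zero) (Or.inl hcP.volume_ne_top)] at hPle
  rw [ENNReal.div_le_iff_le_mul (Or.inl hcR.volume_ne_zero) (Or.inl hcR.volume_ne_top)]
  calc ∫⁻ x in R, ‖f x - ⨍ y in Q, f y‖ₑ ≤ ∫⁻ x in P, ‖f x - ⨍ y in Q, f y‖ₑ :=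
        lintegral_mono_set hRP.1
    _ ≤ 2 * meanOsc f Q * (2 ^ n * volume R) := by rwa [hv] at hPle
    _ = _ := by rw [pow_succ]; ring

open Classical in
/-- The sum of the mean oscillations over the cubes of the stopping family inside `Q`. -/
def localOsc (Q₀ : Set (Fin n → ℝ)) (f : (Fin n → ℝ) → ℝ) (Q : Set (Fin n → ℝ))
    (x : Fin n → ℝ) : ℝ≥0∞ :=
  ∑' T : oscFamily Q₀ f, if (T : Set (Fin n → ℝ)) ⊆ Q then
    (T : Set (Fin n → ℝ)).indicator (fun _ => meanOsc f T) x else 0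

lemma localOsc_le_fullOsc (f : (Fin n → ℝ) → ℝ) (Q : Set (Fin n → ℝ)) (x : Fin n → ℝ) :
    localOsc Q₀ f Q x ≤ fullOsc f (oscFamily Q₀ f) x := by
  refine ENNReal.tsum_le_tsum fun T => ?_
  split_ifs
  · exact le_rfl
  · exact zero_le

lemma meanOsc_le_localOsc {f : (Fin n → ℝ) → ℝ} {Q : Set (Fin n → ℝ)} {x : Fin n → ℝ}
    (hQ : Q ∈ oscFamily Q₀ f) (hx : x ∈ Q) : meanOsc f Q ≤ localOsc Q₀ f Q x := by
  refine le_trans (le_of_eq ?_) (ENNReal.le_tsum ⟨Q, hQ⟩)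
  simp [hx]

/-- The term of `Q` itself does not occur in the sum over cubes inside `R`, so the telescoping
counts each cube once. -/
lemma meanOsc_add_localOsc_le {f : (Fin n → ℝ) → ℝ} {Q R : Set (Fin n → ℝ)} {x : Fin n → ℝ}
    (hQ : Q ∈ oscFamily Q₀ f) (hx : x ∈ Q) (hRQ : R ⊂ Q) :
    meanOsc f Q + localOsc Q₀ f R x ≤ localOsc Q₀ f Q x := by
  classical
  conv_rhs => rw [localOsc, ENNReal.tsum_eq_add_tsum_ite (⟨Q, hQ⟩ : oscFamily Q₀ f)]
  refine add_le_add (by simp [hx]) (ENNReal.tsum_le_tsum fun T => ?_)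
  by_cases hT : (T : Set (Fin n → ℝ)) ⊆ R
  · have hne : T ≠ ⟨Q, hQ⟩ := by
      rintro rfl
      exact hRQ.2 hT
    rw [if_pos hT, if_neg hne, if_pos (hT.trans hRQ.1)]
  · rw [if_neg hT]
    exact zero_le

/-- If `R` lies in a selected cube `T` of `Q`, replacing `f_Q` by `f_T` costs `2 ^ (n + 1) * meanOsc
f Q`, and the argument continues in `T`. Otherwise `R` violates the selection criterion, and its
average is at most `2 * meanOsc f Q`. -/
lemma average_enorm_sub_le_localOsc (h : IsDyadicGrid Q₀ lev) {f : (Fin n → ℝ) → ℝ}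
    (hf : IntegrableOn f Q₀) {k : ℕ} {R : Set (Fin n → ℝ)} (hR : R ∈ lev k) {x : Fin n → ℝ}
    (hx : x ∈ R) (d : ℕ) {j : ℕ} {Q : Set (Fin n → ℝ)} (hQ : Q ∈ oscFamily Q₀ f)
    (hQj : Q ∈ lev j) (hd : k - j ≤ d) (hRQ : R ⊆ Q) :
    (∫⁻ y in R, ‖f y - ⨍ z in Q, f z‖ₑ) / volume R ≤ 2 ^ (n + 1) * localOsc Q₀ f Q x := by
  -- The induction is on the level gap between `Q` and `R`; it is strong because `T` may lie several
  -- levels below `Q`.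
  induction d using Nat.strong_induction_on generalizing j Q with
  | _ d ih =>
  have hRD : R ∈ dyadicSubcubes Q₀ := (h.mem_iff _).2 ⟨k, hR⟩
  have hQD := oscFamily_subset h f hQ
  by_cases hex : ∃ T ∈ oscStops Q₀ f Q, R ⊆ T
  · obtain ⟨T, hT, hRT⟩ := hex
    have hTQ := ssubset_of_mem_oscStops hT
    obtain ⟨i, hi⟩ := (h.mem_iff _).1 (oscStops_subset f Q hT)
    have hji := h.level_lt_of_ssubset hQj hi hTQ
    have hjk := h.level_lt_of_ssubset hQj hR (hRT.trans_ssubset hTQ)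
    have hTF : T ∈ oscFamily Q₀ f := by
      obtain ⟨g, hg⟩ := hQ
      exact ⟨g + 1, Q, hg, hT⟩
    have h1 := ih (k - i) (by omega) hTF hi le_rfl hRT
    calc (∫⁻ y in R, ‖f y - ⨍ z in Q, f z‖ₑ) / volume R
        ≤ (∫⁻ y in R, ‖f y - ⨍ z in T, f z‖ₑ) / volume R + ‖(⨍ z in T, f z) - ⨍ z in Q, f z‖ₑ :=
          average_enorm_sub_le f (isCube_of_mem_dyadicSubcubes hRD) _ _
      _ ≤ 2 ^ (n + 1) * localOsc Q₀ f T x + 2 ^ (n + 1) * meanOsc f Q :=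
          add_le_add h1 (enorm_average_sub_le_of_mem_oscStops h hf hQD hT)
      _ = 2 ^ (n + 1) * (meanOsc f Q + localOsc Q₀ f T x) := by ring
      _ ≤ _ := by gcongr; exact meanOsc_add_localOsc_le hQ (hRQ hx) hTQ
  · have h1 : (∫⁻ y in R, ‖f y - ⨍ z in Q, f z‖ₑ) / volume R ≤ 2 * meanOsc f Q := by
      by_contra hlt
      obtain ⟨T, hT, hRT⟩ := h.exists_maximal
        (p := fun R => R ∈ dyadicSubcubes Q₀ ∧ R ⊆ Q ∧
          2 * meanOsc f Q < (∫⁻ x in R, ‖f x - ⨍ y in Q, f y‖ₑ) / volume R)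
        (fun _ hp => hp.1) ⟨hRD, hRQ, not_le.1 hlt⟩
      exact hex ⟨T, hT, hRT⟩
    refine h1.trans (mul_le_mul' ?_ (meanOsc_le_localOsc hQ (hRQ hx)))
    rw [pow_succ]
    exact le_mul_of_one_le_left' (one_le_pow₀ (by norm_num))

/-- The maximal function of `f - f_{Q₀}` is dominated by the oscillations along the stopping
family of `f`. -/
lemma dyadicMax_le_fullOsc (h : IsDyadicGrid Q₀ lev) {f : (Fin n → ℝ) → ℝ}
    (hf : IntegrableOn f Q₀) (x : Fin n → ℝ) :
    dyadicMax Q₀ (fun y => ‖f y - ⨍ z in Q₀, f z‖ₑ) x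
      ≤ 2 ^ (n + 1) * fullOsc f (oscFamily Q₀ f) x := by
  refine iSup₂_le fun R hR => ?_
  by_cases hx : x ∈ R
  · rw [indicator_of_mem hx]
    obtain ⟨k, hk⟩ := (h.mem_iff _).1 hR
    refine (average_enorm_sub_le_localOsc h hf hk hx k (j := 0) (Q := Q₀) ⟨0, rfl⟩
      (by simp [h.zero]) (by simp) (h.subset_root hR)).trans ?_
    gcongr
    exact localOsc_le_fullOsc f Q₀ x
  · rw [indicator_of_notMem hx]
    exact zero_le

end construction

/-! ### Elementary inequalities for `x log (e + x)` -/

lemma one_le_log_exp_one_add {x : ℝ} (hx : 0 ≤ x) : 1 ≤ Real.log (Real.exp 1 + x) := by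
  rw [Real.le_log_iff_exp_le (by positivity)]
  linarith

lemma posLog_le_log_exp_one_add {x : ℝ} (hx : 0 ≤ x) :
    Real.posLog x ≤ Real.log (Real.exp 1 + x) := by
  rw [Real.posLog_eq_log_max_one hx]
  refine Real.log_le_log (by positivity) (max_le ?_ ?_)
  · linarith [Real.add_one_le_exp (1 : ℝ)]
  · linarith [Real.exp_pos 1]

lemma log_exp_one_add_le {x : ℝ} (hx : 0 ≤ x) :
    Real.log (Real.exp 1 + x) ≤ 2 + Real.posLog x := by
  have h2 : (2 : ℝ) ≤ Real.exp 1 := by linarith [Real.add_one_le_exp (1 : ℝ)]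
  have hm : (0 : ℝ) < max 1 x := by positivity
  rw [Real.posLog_eq_log_max_one hx, ← Real.log_exp 2, ← Real.log_mul (by positivity) hm.ne']
  refine Real.log_le_log (by positivity) ?_
  rw [show (2 : ℝ) = 1 + 1 by norm_num, Real.exp_add]
  have h3 : (1 : ℝ) ≤ max 1 x := le_max_left _ _
  have h4 : x ≤ max 1 x := le_max_right _ _
  have h5 : Real.exp 1 * 1 ≤ Real.exp 1 * max 1 x := by gcongr
  have h6 : 2 * max 1 x ≤ Real.exp 1 * max 1 x := by gcongr
  have h7 : 2 * (Real.exp 1 * max 1 x) ≤ Real.exp 1 * (Real.exp 1 * max 1 x) := by gcongr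
  linarith

lemma posLog_two_mul_le {x : ℝ} (hx : 0 ≤ x) :
    Real.posLog (2 * x) ≤ 2 * Real.log (Real.exp 1 + x) := by
  have h1 := one_le_log_exp_one_add hx
  have h2 := posLog_le_log_exp_one_add hx
  have h3 := Real.posLog_nat_mul (n := 2) (x := x)
  have h4 := Real.log_two_lt_d9
  push_cast at h3
  linarith

/-- Since `e + K x ≤ (1 + K)(e + x)`, the logarithm splits, and `log (e + x) ≥ 1` absorbs the
constant `log (1 + K)`. -/
lemma mul_log_exp_one_add_mul_le {K x : ℝ} (hK : 0 ≤ K) (hx : 0 ≤ x) :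
    K * x * Real.log (Real.exp 1 + K * x)
      ≤ K * (1 + Real.log (1 + K)) * (x * Real.log (Real.exp 1 + x)) := by
  have he := Real.exp_pos 1
  have h1 := one_le_log_exp_one_add hx
  have h0 : 0 ≤ Real.log (1 + K) := Real.log_nonneg (by linarith)
  have h2 : Real.log (Real.exp 1 + K * x) ≤ Real.log (1 + K) + Real.log (Real.exp 1 + x) := by
    rw [← Real.log_mul (by positivity) (by positivity)]
    refine Real.log_le_log (by positivity) ?_
    nlinarith [mul_nonneg hK he.le]
  calc K * x * Real.log (Real.exp 1 + K * x)
      ≤ K * x * (Real.log (1 + K) + Real.log (Real.exp 1 + x)) := by gcongr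
    _ ≤ K * x * (Real.log (1 + K) * Real.log (Real.exp 1 + x) + Real.log (Real.exp 1 + x)) := by
        gcongr
        exact le_mul_of_one_le_right h0 h1
    _ = _ := by ring

lemma div_mul_log_exp_one_add_le {K x : ℝ} (hK : 1 ≤ K) (hx : 0 ≤ x) :
    x / K * Real.log (Real.exp 1 + x / K) ≤ K⁻¹ * (x * Real.log (Real.exp 1 + x)) := by
  have h1 : x / K ≤ x := div_le_self hx hK
  have h0 : 0 ≤ x / K := by positivity
  calc x / K * Real.log (Real.exp 1 + x / K) ≤ x / K * Real.log (Real.exp 1 + x) := by gcongr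
    _ = _ := by ring

lemma mul_log_exp_one_add_mono {x y : ℝ} (hx : 0 ≤ x) (hxy : x ≤ y) :
    x * Real.log (Real.exp 1 + x) ≤ y * Real.log (Real.exp 1 + y) := by
  have := one_le_log_exp_one_add hx
  have hy : 0 ≤ y := hx.trans hxy
  have : Real.log (Real.exp 1 + x) ≤ Real.log (Real.exp 1 + y) := by gcongr
  gcongr

lemma abs_sub_mul_log_le (a c : ℝ) :
    |a - c| * Real.log (Real.exp 1 + |a - c|)
      ≤ 2 * (1 + Real.log (1 + 2)) * (|a| * Real.log (Real.exp 1 + |a|)) +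
        2 * (1 + Real.log (1 + 2)) * (|c| * Real.log (Real.exp 1 + |c|)) := by
  have hl : 0 ≤ Real.log (1 + 2) := Real.log_nonneg (by norm_num)
  have h0 : ∀ x : ℝ, 0 ≤ |x| * Real.log (Real.exp 1 + |x|) := fun x =>
    mul_nonneg (abs_nonneg x) (by linarith [one_le_log_exp_one_add (abs_nonneg x)])
  have hac := abs_sub a c
  rcases le_total |a| |c| with h | h
  · have h1 := mul_log_exp_one_add_mono (abs_nonneg (a - c))
      (show |a - c| ≤ 2 * |c| by linarith)
    have h2 := mul_log_exp_one_add_mul_le (K := 2) (by norm_num) (abs_nonneg c)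
    have h3 : 0 ≤ 2 * (1 + Real.log (1 + 2)) * (|a| * Real.log (Real.exp 1 + |a|)) :=
      mul_nonneg (by positivity) (h0 a)
    linarith
  · have h1 := mul_log_exp_one_add_mono (abs_nonneg (a - c))
      (show |a - c| ≤ 2 * |a| by linarith)
    have h2 := mul_log_exp_one_add_mul_le (K := 2) (by norm_num) (abs_nonneg a)
    have h3 : 0 ≤ 2 * (1 + Real.log (1 + 2)) * (|c| * Real.log (Real.exp 1 + |c|)) :=
      mul_nonneg (by positivity) (h0 c)
    linarith

lemma le_exp_one_add_mul_posLog {x : ℝ} (hx : 0 ≤ x) : x ≤ Real.exp 1 + x * Real.posLog x := by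
  rcases le_total x (Real.exp 1) with h | h
  · have := mul_nonneg hx (Real.posLog_nonneg (x := x))
    linarith
  · have h1 : 1 ≤ Real.posLog x := by
      rw [Real.posLog_eq_log (by rw [abs_of_nonneg hx]; linarith [Real.add_one_le_exp (1 : ℝ)]),
        Real.le_log_iff_exp_le ((Real.exp_pos 1).trans_le h)]
      exact h
    nlinarith [Real.exp_pos 1]

/-! ### The Zygmund space and its Luxemburg norm -/

section zygmund

variable {n : ℕ} {Q₀ : Set (Fin n → ℝ)}

/-- The integral of `|f| log (e + |f|)` over `Q₀`. -/
def zygmundIntegral (f : (Fin n → ℝ) → ℝ) (Q₀ : Set (Fin n → ℝ)) : ℝ≥0∞ :=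
  ∫⁻ x in Q₀, ENNReal.ofReal (|f x| * Real.log (Real.exp 1 + |f x|))

lemma zygmundIntegral_sub_lt_top (hQ₀ : IsCube Q₀) {f : (Fin n → ℝ) → ℝ} (c : ℝ)
    (hf : zygmundIntegral f Q₀ < ∞) : zygmundIntegral (fun x => f x - c) Q₀ < ∞ := by
  have hle : zygmundIntegral (fun x => f x - c) Q₀
      ≤ ∫⁻ x in Q₀, (ENNReal.ofReal (2 * (1 + Real.log (1 + 2))) *
        ENNReal.ofReal (|f x| * Real.log (Real.exp 1 + |f x|)) +
        ENNReal.ofReal (2 * (1 + Real.log (1 + 2)) * (|c| * Real.log (Real.exp 1 + |c|)))) := by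
    refine lintegral_mono fun x => ?_
    have hl : 0 ≤ Real.log (1 + 2) := Real.log_nonneg (by norm_num)
    rw [← ENNReal.ofReal_mul (by positivity)]
    exact (ENNReal.ofReal_le_ofReal (abs_sub_mul_log_le (f x) c)).trans ENNReal.ofReal_add_le
  refine hle.trans_lt ?_
  rw [lintegral_add_right _ measurable_const, lintegral_const_mul' _ _ ENNReal.ofReal_ne_top,
    setLIntegral_const]
  exact ENNReal.add_lt_top.2 ⟨ENNReal.mul_lt_top ENNReal.ofReal_lt_top hf,
    ENNReal.mul_lt_top ENNReal.ofReal_lt_top hQ₀.volume_ne_top.lt_top⟩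

lemma zygmundIntegral_lt_top_iff (hQ₀ : IsCube Q₀) {f : (Fin n → ℝ) → ℝ} :
    zygmundIntegral f Q₀ < ∞ ↔
      (∫⁻ x in Q₀, ENNReal.ofReal (|f x| * Real.posLog |f x|)) < ∞ := by
  constructor
  · refine fun hf => lt_of_le_of_lt (lintegral_mono fun x => ENNReal.ofReal_le_ofReal ?_) hf
    gcongr
    exact posLog_le_log_exp_one_add (abs_nonneg _)
  · intro hf
    have hle : zygmundIntegral f Q₀
        ≤ ∫⁻ x in Q₀, (3 * ENNReal.ofReal (|f x| * Real.posLog |f x|) +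
          ENNReal.ofReal (2 * Real.exp 1)) := by
      refine lintegral_mono fun x => ?_
      have h0 := abs_nonneg (f x)
      have h1 := log_exp_one_add_le h0
      have h2 := le_exp_one_add_mul_posLog h0
      -- From `x log (e + x) ≤ 2 x + x log⁺ x`, with `x ≤ e + x log⁺ x` applied to the linear term.
      have h3 : |f x| * Real.log (Real.exp 1 + |f x|)
          ≤ 3 * (|f x| * Real.posLog |f x|) + 2 * Real.exp 1 := by
        nlinarith [mul_le_mul_of_nonneg_left h1 h0]
      refine (ENNReal.ofReal_le_ofReal h3).trans (ENNReal.ofReal_add_le.trans (le_of_eq ?_))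
      rw [ENNReal.ofReal_mul (by norm_num)]
      simp
    refine hle.trans_lt ?_
    rw [lintegral_add_right _ measurable_const, lintegral_const_mul' _ _ (by simp),
      setLIntegral_const]
    exact ENNReal.add_lt_top.2 ⟨ENNReal.mul_lt_top (by simp) hf,
      ENNReal.mul_lt_top ENNReal.ofReal_lt_top hQ₀.volume_ne_top.lt_top⟩

lemma integrableOn_of_mem_LLogL (hQ₀ : IsCube Q₀) {f : (Fin n → ℝ) → ℝ} (hf : f ∈ LLogL Q₀) :
    IntegrableOn f Q₀ := by
  refine ⟨hf.1, ?_⟩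
  have hle : ∫⁻ x in Q₀, ‖f x‖ₑ ≤ ∫⁻ x in Q₀, (ENNReal.ofReal (Real.exp 1) +
      ENNReal.ofReal (|f x| * Real.posLog |f x|)) := by
    refine lintegral_mono fun x => ?_
    rw [← ofReal_norm, Real.norm_eq_abs]
    exact (ENNReal.ofReal_le_ofReal (le_exp_one_add_mul_posLog (abs_nonneg _))).trans
      ENNReal.ofReal_add_le
  refine lt_of_le_of_lt hle ?_
  rw [lintegral_add_left measurable_const, setLIntegral_const]
  exact ENNReal.add_lt_top.2
    ⟨ENNReal.mul_lt_top ENNReal.ofReal_lt_top hQ₀.volume_ne_top.lt_top, hf.2⟩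

/-- The condition on `t` in the Luxemburg norm, as an inequality between integrals. -/
lemma luxemburg_condition_iff (hQ₀ : IsCube Q₀) {f : (Fin n → ℝ) → ℝ} {t : ℝ} :
    (⨍⁻ x in Q₀, ENNReal.ofReal (|f x| / t * Real.log (Real.exp 1 + |f x| / t)) ∂volume) ≤ 1 ↔
      ∫⁻ x in Q₀, ENNReal.ofReal (|f x| / t * Real.log (Real.exp 1 + |f x| / t))
        ≤ volume Q₀ := by
  rw [setLAverage_eq, ENNReal.div_le_iff_le_mul (Or.inl hQ₀.volume_ne_zero)
    (Or.inl hQ₀.volume_ne_top), one_mul]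

lemma llogLNorm_lt_top_iff (hQ₀ : IsCube Q₀) {f : (Fin n → ℝ) → ℝ} :
    llogLNorm f Q₀ < ∞ ↔ zygmundIntegral f Q₀ < ∞ := by
  constructor
  · intro hf
    simp only [llogLNorm, iInf_lt_iff] at hf
    obtain ⟨t, ht, hcond, -⟩ := hf
    rw [luxemburg_condition_iff hQ₀] at hcond
    have hle : zygmundIntegral f Q₀ ≤ ∫⁻ x in Q₀, ENNReal.ofReal (t * (1 + Real.log (1 + t))) *
        ENNReal.ofReal (|f x| / t * Real.log (Real.exp 1 + |f x| / t)) := by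
      refine lintegral_mono fun x => ?_
      have h0 : 0 ≤ Real.log (1 + t) := Real.log_nonneg (by linarith)
      rw [← ENNReal.ofReal_mul (by positivity)]
      refine ENNReal.ofReal_le_ofReal ?_
      have := mul_log_exp_one_add_mul_le ht.le (x := |f x| / t) (by positivity)
      rwa [mul_div_cancel₀ _ ht.ne'] at this
    refine hle.trans_lt ?_
    rw [lintegral_const_mul' _ _ ENNReal.ofReal_ne_top]
    exact ENNReal.mul_lt_top ENNReal.ofReal_lt_top (hcond.trans_lt hQ₀.volume_ne_top.lt_top)
  · intro hf
    set A := zygmundIntegral f Q₀ / volume Q₀ with hA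
    have hAt : A ≠ ∞ := ENNReal.div_ne_top hf.ne hQ₀.volume_ne_zero
    -- `t ≥ 1` allows a factor `1 / t` to be pulled out of the Young function, and `t ≥ A` then
    -- makes the average at most one.
    set t : ℝ := 1 + A.toReal with ht
    have ht1 : 1 ≤ t := by linarith [ENNReal.toReal_nonneg (a := A)]
    have ht0 : 0 < t := by linarith
    refine lt_of_le_of_lt (iInf₂_le_of_le t ht0 (iInf_le _ ?_)) (ENNReal.ofReal_lt_top (r := t))
    rw [luxemburg_condition_iff hQ₀]
    calc ∫⁻ x in Q₀, ENNReal.ofReal (|f x| / t * Real.log (Real.exp 1 + |f x| / t))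
        ≤ ∫⁻ x in Q₀, ENNReal.ofReal t⁻¹ *
          ENNReal.ofReal (|f x| * Real.log (Real.exp 1 + |f x|)) := by
          refine lintegral_mono fun x => ?_
          rw [← ENNReal.ofReal_mul (by positivity)]
          exact ENNReal.ofReal_le_ofReal (div_mul_log_exp_one_add_le ht1 (abs_nonneg _))
      _ = ENNReal.ofReal t⁻¹ * (A * volume Q₀) := by
          rw [lintegral_const_mul' _ _ ENNReal.ofReal_ne_top, hA,
            ENNReal.div_mul_cancel hQ₀.volume_ne_zero hQ₀.volume_ne_top]
          rfl
      _ ≤ ENNReal.ofReal t⁻¹ * (ENNReal.ofReal t * volume Q₀) := by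
          gcongr
          rw [← ENNReal.ofReal_toReal hAt]
          exact ENNReal.ofReal_le_ofReal (by linarith)
      _ = volume Q₀ := by
          rw [← mul_assoc, ← ENNReal.ofReal_mul (by positivity), inv_mul_cancel₀ ht0.ne',
            ENNReal.ofReal_one, one_mul]

lemma dyadicMax_const_mul {c : ℝ≥0∞} (hc : c ≠ ∞) (g : (Fin n → ℝ) → ℝ≥0∞) (x : Fin n → ℝ) :
    dyadicMax Q₀ (fun y => c * g y) x = c * dyadicMax Q₀ g x := by
  simp only [dyadicMax, ENNReal.mul_iSup]
  refine iSup_congr fun Q => iSup_congr fun _ => ?_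
  rw [lintegral_const_mul' _ _ hc, mul_div_assoc]
  by_cases hx : x ∈ Q <;> simp [hx]

variable {lev : ℕ → Set (Set (Fin n → ℝ))}

/-- By homogeneity the `L log L` bound is applied to `|g| / t` for admissible `t`. The constant is
`5 = 1 + 2 * 2`, the last factor coming from `posLog_two_mul_le`. -/
lemma lintegral_dyadicMax_le_llogLNorm (h : IsDyadicGrid Q₀ lev) {g : (Fin n → ℝ) → ℝ}
    (hg : AEMeasurable g (volume.restrict Q₀)) :
    ∫⁻ x in Q₀, dyadicMax Q₀ (fun y => ‖g y‖ₑ) x ≤ 5 * volume Q₀ * llogLNorm g Q₀ := by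
  have hQ₀ := isCube_of_mem_dyadicSubcubes h.mem_self
  have h50 : 5 * volume Q₀ ≠ 0 := mul_ne_zero (by norm_num) hQ₀.volume_ne_zero
  have h5t : 5 * volume Q₀ ≠ ∞ := ENNReal.mul_ne_top (by simp) hQ₀.volume_ne_top
  rw [mul_comm, ← ENNReal.div_le_iff_le_mul (Or.inl h50) (Or.inl h5t)]
  refine le_iInf fun t => le_iInf fun ht => le_iInf fun hcond => ?_
  rw [luxemburg_condition_iff hQ₀] at hcond
  rw [ENNReal.div_le_iff_le_mul (Or.inl h50) (Or.inl h5t)]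
  have h1 := lintegral_dyadicMax_le h (G := fun x => |g x| / t)
    (hg.abs.div_const t) (fun x => by positivity)
  have h2 : ∫⁻ x in Q₀, ENNReal.ofReal (|g x| / t * Real.posLog (2 * (|g x| / t)))
      ≤ 2 * volume Q₀ := by
    calc _ ≤ ∫⁻ x in Q₀, 2 *
          ENNReal.ofReal (|g x| / t * Real.log (Real.exp 1 + |g x| / t)) := by
          refine lintegral_mono fun x => ?_
          have h0 : 0 ≤ |g x| / t := by positivity
          rw [show (2 : ℝ≥0∞) = ENNReal.ofReal 2 by simp, ← ENNReal.ofReal_mul (by norm_num)]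
          refine ENNReal.ofReal_le_ofReal ?_
          have := mul_le_mul_of_nonneg_left (posLog_two_mul_le h0) h0
          linarith
      _ ≤ _ := by
          rw [lintegral_const_mul' _ _ (by simp)]
          gcongr
  have h3 : ∀ x, dyadicMax Q₀ (fun y => ‖g y‖ₑ) x
      = ENNReal.ofReal t * dyadicMax Q₀ (fun y => ENNReal.ofReal (|g y| / t)) x := by
    intro x
    rw [← dyadicMax_const_mul ENNReal.ofReal_ne_top]
    congr 1
    ext y
    rw [← ENNReal.ofReal_mul ht.le, mul_div_cancel₀ _ ht.ne', ← ofReal_norm, Real.norm_eq_abs]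
  simp_rw [h3]
  rw [lintegral_const_mul' _ _ ENNReal.ofReal_ne_top]
  gcongr
  calc _ ≤ volume Q₀ + 2 * (2 * volume Q₀) := h1.trans (by gcongr)
    _ = 5 * volume Q₀ := by ring

/-- If `∫ M g ≤ t |Q₀|`, Stein's inequality for `G = |g| / t` and `G log (e + G) ≤ 2 G + G log⁺ G`
bound the Young integral by `(2 + 2 ^ n) |Q₀|`. Dividing by a further `K = 2 + 2 ^ n` makes `K * t`
admissible. -/
lemma llogLNorm_le_lintegral_dyadicMax (h : IsDyadicGrid Q₀ lev) {g : (Fin n → ℝ) → ℝ}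
    (hg : IntegrableOn g Q₀) :
    volume Q₀ * llogLNorm g Q₀
      ≤ (2 + 2 ^ n) * ∫⁻ x in Q₀, dyadicMax Q₀ (fun y => ‖g y‖ₑ) x := by
  have hQ₀ := isCube_of_mem_dyadicSubcubes h.mem_self
  have hV0 := hQ₀.volume_ne_zero
  have hVt := hQ₀.volume_ne_top
  set A := ∫⁻ x in Q₀, dyadicMax Q₀ (fun y => ‖g y‖ₑ) x with hA
  rcases eq_or_ne A ∞ with hAt | hAt
  · rw [hAt, ENNReal.mul_top (by simp)]
    exact le_top
  set K : ℝ := 2 + 2 ^ n with hK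
  have hK1 : 1 ≤ K := by have : (0 : ℝ) ≤ 2 ^ n := by positivity
                         linarith
  have hK0 : 0 < K := by linarith
  have hKe : ENNReal.ofReal K = 2 + 2 ^ n := by
    rw [hK, ENNReal.ofReal_add (by norm_num) (by positivity), ENNReal.ofReal_pow (by norm_num)]
    simp
  have key : ∀ t : ℝ, 0 < t → A ≤ ENNReal.ofReal t * volume Q₀ →
      llogLNorm g Q₀ ≤ ENNReal.ofReal (K * t) := by
    intro t ht hAle
    refine iInf₂_le_of_le (K * t) (by positivity) (iInf_le _ ?_)
    rw [luxemburg_condition_iff hQ₀]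
    set G : (Fin n → ℝ) → ℝ := fun x => |g x| / t with hG
    have hG0 : ∀ x, 0 ≤ G x := fun x => by positivity
    have hGm : AEMeasurable G (volume.restrict Q₀) := hg.aemeasurable.abs.div_const t
    have hGe : (fun y => ENNReal.ofReal (G y)) = fun y => ENNReal.ofReal t⁻¹ * ‖g y‖ₑ := by
      ext y
      rw [← ofReal_norm, Real.norm_eq_abs, ← ENNReal.ofReal_mul (by positivity), hG]
      congr 1; ring
    have hMG : ∫⁻ x in Q₀, dyadicMax Q₀ (fun y => ENNReal.ofReal (G y)) x ≤ volume Q₀ := by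
      rw [hGe]
      simp_rw [dyadicMax_const_mul ENNReal.ofReal_ne_top]
      rw [lintegral_const_mul' _ _ ENNReal.ofReal_ne_top]
      calc _ ≤ ENNReal.ofReal t⁻¹ * (ENNReal.ofReal t * volume Q₀) := by gcongr
        _ = volume Q₀ := by
          rw [← mul_assoc, ← ENNReal.ofReal_mul (by positivity), inv_mul_cancel₀ ht.ne',
            ENNReal.ofReal_one, one_mul]
    have hle : ∀ᵐ x ∂volume.restrict Q₀,
        ENNReal.ofReal (G x) ≤ dyadicMax Q₀ (fun y => ENNReal.ofReal (G y)) x := by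
      filter_upwards [ae_enorm_le_dyadicMax hQ₀ hg] with x hx
      rw [hGe, dyadicMax_const_mul ENNReal.ofReal_ne_top, congrFun hGe x]
      gcongr
    have havg : ∫⁻ x in Q₀, ENNReal.ofReal (G x) ≤ volume Q₀ :=
      (lintegral_mono_ae hle).trans hMG
    have hStein := lintegral_mul_posLog_le h hGm hG0 havg hle
    calc ∫⁻ x in Q₀, ENNReal.ofReal (|g x| / (K * t) *
          Real.log (Real.exp 1 + |g x| / (K * t)))
        ≤ ∫⁻ x in Q₀, ENNReal.ofReal K⁻¹ * (2 * ENNReal.ofReal (G x) +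
            ENNReal.ofReal (G x * Real.posLog (G x))) := by
          refine lintegral_mono fun x => ?_
          have e : |g x| / (K * t) = G x / K := by rw [hG]; field_simp
          have h1 := div_mul_log_exp_one_add_le hK1 (hG0 x)
          have h2 := mul_le_mul_of_nonneg_left (log_exp_one_add_le (hG0 x)) (hG0 x)
          rw [e]
          refine (ENNReal.ofReal_le_ofReal h1).trans ?_
          rw [ENNReal.ofReal_mul (by positivity)]
          gcongr
          refine (ENNReal.ofReal_le_ofReal h2).trans ?_
          rw [mul_add, mul_comm (G x) 2]
          refine ENNReal.ofReal_add_le.trans (le_of_eq ?_)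
          rw [ENNReal.ofReal_mul (by norm_num)]
          simp
      _ = ENNReal.ofReal K⁻¹ * ((2 * ∫⁻ x in Q₀, ENNReal.ofReal (G x)) +
            ∫⁻ x in Q₀, ENNReal.ofReal (G x * Real.posLog (G x))) := by
          rw [lintegral_const_mul' _ _ ENNReal.ofReal_ne_top,
            lintegral_add_left' (hGm.ennreal_ofReal.const_mul 2), lintegral_const_mul' _ _ (by simp)]
      _ ≤ ENNReal.ofReal K⁻¹ * (2 * volume Q₀ + 2 ^ n * volume Q₀) := by
          gcongr
          exact hStein.trans (mul_le_mul_right hMG _)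
      _ = volume Q₀ := by
          rw [← add_mul, ← hKe, ← mul_assoc, ← ENNReal.ofReal_mul (by positivity),
            inv_mul_cancel₀ hK0.ne', ENNReal.ofReal_one, one_mul]
  have hfin : llogLNorm g Q₀ ≤ (2 + 2 ^ n) * (A / volume Q₀) := by
    -- The average of the maximal function may vanish while `t` must be positive, hence the `ε`.
    refine ENNReal.le_of_forall_pos_le_add fun ε hε _ => ?_
    have hAV : A / volume Q₀ ≠ ∞ := ENNReal.div_ne_top hAt hV0
    have hε' : (0 : ℝ) < ε := hε
    set t : ℝ := (A / volume Q₀).toReal + ε / K with ht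
    have ht0 : 0 < t := by
      have : 0 < (ε : ℝ) / K := by positivity
      linarith [ENNReal.toReal_nonneg (a := A / volume Q₀)]
    have hAt' : A ≤ ENNReal.ofReal t * volume Q₀ := by
      rw [← ENNReal.div_le_iff_le_mul (Or.inl hV0) (Or.inl hVt), ← ENNReal.ofReal_toReal hAV]
      refine ENNReal.ofReal_le_ofReal ?_
      have : 0 < (ε : ℝ) / K := by positivity
      linarith
    refine (key t ht0 hAt').trans (le_of_eq ?_)
    rw [ht, mul_add, mul_div_cancel₀ _ hK0.ne', ENNReal.ofReal_add (by positivity) hε'.le,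
      ENNReal.ofReal_mul hK0.le, ENNReal.ofReal_toReal hAV, hKe, ENNReal.ofReal_coe_nnreal]
  calc volume Q₀ * llogLNorm g Q₀ ≤ volume Q₀ * ((2 + 2 ^ n) * (A / volume Q₀)) := by gcongr
    _ = (2 + 2 ^ n) * (A / volume Q₀ * volume Q₀) := by ring
    _ = _ := by rw [ENNReal.div_mul_cancel hV0 hVt]

end zygmund

/-! ### Comparison of the norms -/

section norms

variable {n : ℕ} {Q₀ : Set (Fin n → ℝ)} {lev : ℕ → Set (Set (Fin n → ℝ))}

lemma sjnNorm_le {f : (Fin n → ℝ) → ℝ} {p b : ℝ≥0∞}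
    (hb : ∀ S, IsSparseFamily Q₀ S → eLpNorm (sparseOsc f S) p (volume.restrict Q₀) ≤ b) :
    sjnNorm f p Q₀ ≤ b := iSup₂_le hb

lemma eLpNorm_sparseOsc_le_sjnNorm {f : (Fin n → ℝ) → ℝ} {p : ℝ≥0∞}
    {S : Set (Set (Fin n → ℝ))} (hS : IsSparseFamily Q₀ S) :
    eLpNorm (sparseOsc f S) p (volume.restrict Q₀) ≤ sjnNorm f p Q₀ :=
  le_iSup₂_of_le S hS le_rfl

lemma sparseChildren_singleton (Q : Set (Fin n → ℝ)) : sparseChildren {Q} Q = ∅ := by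
  refine eq_empty_of_forall_notMem fun R hR => ?_
  obtain ⟨⟨rfl, hlt⟩, -⟩ := hR
  exact hlt.2 subset_rfl

lemma isSparseFamily_singleton {Q : Set (Fin n → ℝ)} (hQ : Q ∈ dyadicSubcubes Q₀) :
    IsSparseFamily Q₀ {Q} := by
  refine ⟨singleton_subset_iff.2 hQ, ?_⟩
  rintro R rfl
  rw [sparseChildren_singleton]
  simp

lemma sparseOsc_singleton (f : (Fin n → ℝ) → ℝ) {Q : Set (Fin n → ℝ)} {x : Fin n → ℝ}
    (hx : x ∈ Q) : sparseOsc f {Q} x = meanOsc f Q := by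
  rw [sparseOsc_eq, tsum_eq_single (⟨Q, rfl⟩ : ({Q} : Set (Set (Fin n → ℝ))))]
  · simp [sparsePart, sparseChildren_singleton, hx]
  · rintro ⟨R, rfl⟩ hne
    exact absurd rfl hne

/-- At each point `sparseOsc` is bounded by a single mean oscillation. Conversely `{Q}` is sparse
and its oscillation sum is constant on `Q`, a set of positive measure. -/
lemma sjnNorm_top (h : IsDyadicGrid Q₀ lev) (f : (Fin n → ℝ) → ℝ) :
    sjnNorm f ∞ Q₀ = dyadicBmoNorm f Q₀ := by
  apply le_antisymm
  · refine sjnNorm_le fun S hS => ?_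
    rw [eLpNorm_exponent_top, eLpNormEssSup]
    refine essSup_le_of_ae_le _ (Filter.Eventually.of_forall fun x => ?_)
    simp only [enorm_eq_self]
    exact sparseOsc_le h hS.1 f fun Q hQ _ => le_iSup₂_of_le Q (hS.1 hQ) le_rfl
  · refine iSup₂_le fun Q hQ => ?_
    refine le_trans ?_ (eLpNorm_sparseOsc_le_sjnNorm (isSparseFamily_singleton hQ))
    have hc := isCube_of_mem_dyadicSubcubes hQ
    have hae : ∀ᵐ x ∂volume.restrict Q₀, ‖sparseOsc f {Q} x‖ₑ
        ≤ eLpNorm (sparseOsc f {Q}) ∞ (volume.restrict Q₀) := by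
      rw [eLpNorm_exponent_top]
      exact enorm_ae_le_eLpNormEssSup _ _
    have hae' : ∀ᵐ x ∂volume.restrict Q, x ∈ Q ∧ ‖sparseOsc f {Q} x‖ₑ
        ≤ eLpNorm (sparseOsc f {Q}) ∞ (volume.restrict Q₀) :=
      (ae_restrict_mem hc.measurableSet).and
        (ae_restrict_of_ae_restrict_of_subset (h.subset_root hQ) hae)
    have : (ae (volume.restrict Q)).NeBot := ae_neBot.2 (by
      rw [Ne, Measure.restrict_eq_zero]; exact hc.volume_ne_zero)
    obtain ⟨x, hx, hle⟩ := hae'.exists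
    rwa [enorm_eq_self, sparseOsc_singleton f hx] at hle

/-- Every subcube is a dyadic subcube of itself, and dyadic subcubes of subcubes are again subcubes.
-/
lemma iSup_sjnNorm_top (hn : 1 ≤ n) (f : (Fin n → ℝ) → ℝ) :
    (⨆ (Q : Set (Fin n → ℝ)) (_ : IsCube Q) (_ : Q ⊆ Q₀), sjnNorm f ∞ Q) = bmoNorm f Q₀ := by
  apply le_antisymm
  · refine iSup_le fun Q => iSup_le fun hQ => iSup_le fun hQQ₀ => ?_
    obtain ⟨lev, h⟩ := hQ.exists_isDyadicGrid hn
    rw [sjnNorm_top h]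
    refine iSup₂_le fun R hR => ?_
    exact le_iSup_of_le R (le_iSup₂_of_le (isCube_of_mem_dyadicSubcubes hR)
      ((h.subset_root hR).trans hQQ₀) le_rfl)
  · refine iSup_le fun Q => iSup_le fun hQ => iSup_le fun hQQ₀ => ?_
    obtain ⟨lev, h⟩ := hQ.exists_isDyadicGrid hn
    refine le_iSup_of_le Q (le_iSup₂_of_le hQ hQQ₀ ?_)
    rw [sjnNorm_top h]
    exact le_iSup₂_of_le Q h.mem_self le_rfl

lemma dyadicBmoNorm_le_bmoNorm (h : IsDyadicGrid Q₀ lev) (f : (Fin n → ℝ) → ℝ) :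
    dyadicBmoNorm f Q₀ ≤ bmoNorm f Q₀ :=
  iSup₂_le fun Q hQ => le_iSup_of_le Q
    (le_iSup₂_of_le (isCube_of_mem_dyadicSubcubes hQ) (h.subset_root hQ) le_rfl)

lemma sjnNorm_le_eLpNorm (h : IsDyadicGrid Q₀ lev) {p : ℝ≥0∞} (hp1 : 1 < p) (hpt : p < ∞)
    {f : (Fin n → ℝ) → ℝ} (hf : IntegrableOn f Q₀) :
    sjnNorm f p Q₀
      ≤ 2 * ENNReal.ofReal (p.toReal * 2 ^ p.toReal / (p.toReal - 1)) ^ (1 / p.toReal) *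
        eLpNorm (fun x => f x - ⨍ y in Q₀, f y) p (volume.restrict Q₀) := by
  have hp0 : p ≠ 0 := (zero_lt_one.trans hp1).ne'
  have hr1 : 1 < p.toReal := by
    rw [← ENNReal.toReal_one]; exact (ENNReal.toReal_lt_toReal (by simp) hpt.ne).2 hp1
  have hr0 : 0 < p.toReal := by linarith
  refine sjnNorm_le fun S hS => ?_
  rw [eLpNorm_eq_lintegral_rpow_enorm_toReal hp0 hpt.ne,
    eLpNorm_eq_lintegral_rpow_enorm_toReal hp0 hpt.ne]
  simp only [enorm_eq_self]
  set r := p.toReal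
  set M := dyadicMax Q₀ fun y => ‖f y - ⨍ z in Q₀, f z‖ₑ with hM
  have hgm : AEMeasurable (fun y => ‖f y - ⨍ z in Q₀, f z‖ₑ) (volume.restrict Q₀) :=
    (hf.aestronglyMeasurable.sub aestronglyMeasurable_const).enorm
  calc (∫⁻ x in Q₀, sparseOsc f S x ^ r) ^ (1 / r)
      ≤ (∫⁻ x in Q₀, 2 ^ r * M x ^ r) ^ (1 / r) := by
        refine ENNReal.rpow_le_rpow (lintegral_mono fun x => ?_) (by positivity)
        rw [← ENNReal.mul_rpow_of_nonneg _ _ hr0.le]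
        exact ENNReal.rpow_le_rpow (sparseOsc_le_dyadicMax h hS.1 hf _ x) hr0.le
    _ = 2 * (∫⁻ x in Q₀, M x ^ r) ^ (1 / r) := by
        rw [lintegral_const_mul' _ _ (ENNReal.rpow_ne_top_of_nonneg hr0.le (by simp)),
          ENNReal.mul_rpow_of_nonneg _ _ (by positivity), ← ENNReal.rpow_mul,
          mul_one_div_cancel hr0.ne', ENNReal.rpow_one]
    _ ≤ 2 * (ENNReal.ofReal (r * 2 ^ r / (r - 1)) *
          ∫⁻ x in Q₀, ‖f x - ⨍ z in Q₀, f z‖ₑ ^ r) ^ (1 / r) := by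
        gcongr 2 * ?_ ^ (1 / r)
        exact lintegral_dyadicMax_rpow_le h hr1 hgm
    _ = _ := by rw [ENNReal.mul_rpow_of_nonneg _ _ (by positivity), mul_assoc]

lemma eLpNorm_le_sjnNorm (h : IsDyadicGrid Q₀ lev) {p : ℝ≥0∞} (hp1 : 1 < p) (hpt : p < ∞)
    {q : ℝ} (hpq : p.toReal.HolderConjugate q)
    {f : (Fin n → ℝ) → ℝ} (hf : IntegrableOn f Q₀) :
    eLpNorm (fun x => f x - ⨍ y in Q₀, f y) p (volume.restrict Q₀)
      ≤ 2 ^ (n + 1) * (2 * ENNReal.ofReal (q * 2 ^ q / (q - 1)) ^ (1 / q)) *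
        sjnNorm f p Q₀ := by
  have hQ₀ := isCube_of_mem_dyadicSubcubes h.mem_self
  have hp0 : p ≠ 0 := (zero_lt_one.trans hp1).ne'
  have hS := isSparseFamily_oscFamily h hf
  have hci : IntegrableOn (fun _ => ⨍ y in Q₀, f y) Q₀ := integrableOn_const hQ₀.volume_ne_top
  have hr0 := hpq.pos
  have hsjn := eLpNorm_sparseOsc_le_sjnNorm (f := f) (p := p) hS
  rw [eLpNorm_eq_lintegral_rpow_enorm_toReal hp0 hpt.ne] at hsjn ⊢
  simp only [enorm_eq_self] at hsjn
  set r := p.toReal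
  have hc : (2 : ℝ≥0∞) ^ (n + 1) ≠ ∞ := by simp
  calc (∫⁻ x in Q₀, ‖f x - ⨍ y in Q₀, f y‖ₑ ^ r) ^ (1 / r)
      ≤ (∫⁻ x in Q₀, ((2 : ℝ≥0∞) ^ (n + 1)) ^ r * fullOsc f (oscFamily Q₀ f) x ^ r)
          ^ (1 / r) := by
        refine ENNReal.rpow_le_rpow (lintegral_mono_ae ?_) (by positivity)
        filter_upwards [ae_enorm_le_dyadicMax hQ₀ (hf.sub hci)] with x hx
        rw [← ENNReal.mul_rpow_of_nonneg _ _ hr0.le]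
        exact ENNReal.rpow_le_rpow (hx.trans (dyadicMax_le_fullOsc h hf x)) hr0.le
    _ = 2 ^ (n + 1) * (∫⁻ x in Q₀, fullOsc f (oscFamily Q₀ f) x ^ r) ^ (1 / r) := by
        rw [lintegral_const_mul' _ _ (ENNReal.rpow_ne_top_of_nonneg hr0.le hc),
          ENNReal.mul_rpow_of_nonneg _ _ (by positivity), ← ENNReal.rpow_mul,
          mul_one_div_cancel hr0.ne', ENNReal.rpow_one]
    _ ≤ 2 ^ (n + 1) * (2 * ENNReal.ofReal (q * 2 ^ q / (q - 1)) ^ (1 / q) *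
          (∫⁻ x in Q₀, sparseOsc f (oscFamily Q₀ f) x ^ r) ^ (1 / r)) := by
        gcongr 2 ^ (n + 1) * ?_
        exact lintegral_fullOsc_rpow_le h hS f hpq
    _ ≤ 2 ^ (n + 1) * (2 * ENNReal.ofReal (q * 2 ^ q / (q - 1)) ^ (1 / q) * sjnNorm f p Q₀) := by
        gcongr
    _ = _ := by ring

lemma sjnNorm_one_le_llogLNorm (h : IsDyadicGrid Q₀ lev) {f : (Fin n → ℝ) → ℝ}
    (hf : IntegrableOn f Q₀) :
    sjnNorm f 1 Q₀ ≤ 10 * (volume Q₀ * llogLNorm (fun x => f x - ⨍ y in Q₀, f y) Q₀) := by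
  refine sjnNorm_le fun S hS => ?_
  rw [eLpNorm_one_eq_lintegral_enorm]
  simp only [enorm_eq_self]
  calc ∫⁻ x in Q₀, sparseOsc f S x
      ≤ ∫⁻ x in Q₀, 2 * dyadicMax Q₀ (fun y => ‖f y - ⨍ z in Q₀, f z‖ₑ) x :=
        lintegral_mono fun x => sparseOsc_le_dyadicMax h hS.1 hf _ x
    _ = 2 * ∫⁻ x in Q₀, dyadicMax Q₀ (fun y => ‖f y - ⨍ z in Q₀, f z‖ₑ) x :=
        lintegral_const_mul' _ _ (by simp)
    _ ≤ 2 * (5 * volume Q₀ * llogLNorm (fun x => f x - ⨍ y in Q₀, f y) Q₀) := by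
        gcongr 2 * ?_
        exact lintegral_dyadicMax_le_llogLNorm h (hf.aemeasurable.sub_const _)
    _ = _ := by ring

/-- The constant collects `2 + 2 ^ n` from Stein's converse, `2 ^ (n + 1)` from the telescoping and
`2` from sparseness. -/
lemma llogLNorm_le_sjnNorm_one (h : IsDyadicGrid Q₀ lev) {f : (Fin n → ℝ) → ℝ}
    (hf : IntegrableOn f Q₀) :
    volume Q₀ * llogLNorm (fun x => f x - ⨍ y in Q₀, f y) Q₀
      ≤ (2 + 2 ^ n) * 2 ^ (n + 2) * sjnNorm f 1 Q₀ := by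
  have hQ₀ := isCube_of_mem_dyadicSubcubes h.mem_self
  have hS := isSparseFamily_oscFamily h hf
  have hci : IntegrableOn (fun _ => ⨍ y in Q₀, f y) Q₀ := integrableOn_const hQ₀.volume_ne_top
  have hsjn := eLpNorm_sparseOsc_le_sjnNorm (f := f) (p := 1) hS
  rw [eLpNorm_one_eq_lintegral_enorm] at hsjn
  simp only [enorm_eq_self] at hsjn
  calc volume Q₀ * llogLNorm (fun x => f x - ⨍ y in Q₀, f y) Q₀
      ≤ (2 + 2 ^ n) * ∫⁻ x in Q₀, dyadicMax Q₀ (fun y => ‖f y - ⨍ y in Q₀, f y‖ₑ) x :=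
        llogLNorm_le_lintegral_dyadicMax h (hf.sub hci)
    _ ≤ (2 + 2 ^ n) * ∫⁻ x in Q₀, 2 ^ (n + 1) * fullOsc f (oscFamily Q₀ f) x := by
        gcongr with x
        exact dyadicMax_le_fullOsc h hf x
    _ ≤ (2 + 2 ^ n) * (2 ^ (n + 1) * (2 * sjnNorm f 1 Q₀)) := by
        rw [lintegral_const_mul' _ _ (by simp)]
        gcongr
        exact (lintegral_fullOsc_le h hS f).trans (mul_le_mul_right hsjn 2)
    _ = _ := by ring

end norms

/-! ### Identification of the spaces -/

section spaces

variable {n : ℕ} {Q₀ : Set (Fin n → ℝ)}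

lemma SJN_eq_LpOn (hn : 1 ≤ n) (hQ₀ : IsCube Q₀) {p : ℝ≥0∞} (hp1 : 1 < p) (hpt : p < ∞) :
    SJN p Q₀ = LpOn p Q₀ := by
  obtain ⟨lev, h⟩ := hQ₀.exists_isDyadicGrid hn
  have : IsFiniteMeasure (volume.restrict Q₀) :=
    isFiniteMeasure_restrict.2 hQ₀.volume_ne_top
  have hr1 : 1 < p.toReal := by
    rw [← ENNReal.toReal_one]; exact (ENNReal.toReal_lt_toReal (by simp) hpt.ne).2 hp1
  ext f
  constructor
  · rintro ⟨hf, hlt⟩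
    have hpq := Real.HolderConjugate.conjExponent hr1
    have hm : MemLp (fun x => f x - ⨍ y in Q₀, f y) p (volume.restrict Q₀) := by
      refine ⟨hf.aestronglyMeasurable.sub aestronglyMeasurable_const, ?_⟩
      refine (eLpNorm_le_sjnNorm h hp1 hpt hpq hf).trans_lt (ENNReal.mul_lt_top ?_ hlt)
      refine ENNReal.mul_lt_top (by simp) (ENNReal.mul_lt_top (by simp) ?_)
      exact ENNReal.rpow_lt_top_of_nonneg (one_div_nonneg.2 hpq.symm.pos.le) (by simp)
    -- The mean is added back: constants are in `L^p` because `Q₀` has finite measure.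
    have := hm.add (memLp_const (⨍ y in Q₀, f y))
    refine (memLp_congr_ae (Filter.Eventually.of_forall fun x => ?_)).1 this
    simp
  · intro hf
    have hfi : IntegrableOn f Q₀ := MemLp.integrable hp1.le hf
    refine ⟨hfi, (sjnNorm_le_eLpNorm h hp1 hpt hfi).trans_lt (ENNReal.mul_lt_top ?_ ?_)⟩
    · exact ENNReal.mul_lt_top (by simp)
        (ENNReal.rpow_lt_top_of_nonneg (by positivity) (by simp))
    · exact (MemLp.sub hf (memLp_const _)).2

lemma SJN_one_eq_LLogL (hn : 1 ≤ n) (hQ₀ : IsCube Q₀) : SJN 1 Q₀ = LLogL Q₀ := by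
  obtain ⟨lev, h⟩ := hQ₀.exists_isDyadicGrid hn
  ext f
  constructor
  · rintro ⟨hf, hlt⟩
    refine ⟨hf.aestronglyMeasurable, (zygmundIntegral_lt_top_iff hQ₀).1 ?_⟩
    have h1 := (llogLNorm_le_sjnNorm_one h hf).trans_lt (ENNReal.mul_lt_top
      (ENNReal.mul_lt_top (by simp [ENNReal.add_lt_top]) (by simp)) hlt)
    have h2 := (llogLNorm_lt_top_iff hQ₀).1 (ENNReal.lt_top_of_mul_ne_top_right h1.ne
      hQ₀.volume_ne_zero)
    simpa using zygmundIntegral_sub_lt_top hQ₀ (-⨍ y in Q₀, f y) h2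
  · intro hf
    have hfi := integrableOn_of_mem_LLogL hQ₀ hf
    refine ⟨hfi, (sjnNorm_one_le_llogLNorm h hfi).trans_lt ?_⟩
    refine ENNReal.mul_lt_top (by simp) (ENNReal.mul_lt_top hQ₀.volume_ne_top.lt_top ?_)
    exact (llogLNorm_lt_top_iff hQ₀).2 (zygmundIntegral_sub_lt_top hQ₀ _
      ((zygmundIntegral_lt_top_iff hQ₀).2 hf.2))

end spaces

end

theorem mainTheorem2 (n : ℕ) (hn : 1 ≤ n) :
    -- the case 1 < p < ∞
    (∀ p : ℝ≥0∞, 1 < p → p < ∞ →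
      (∀ Q₀ : Set (Fin n → ℝ), IsCube Q₀ → SJN p Q₀ = LpOn p Q₀) ∧
      ∃ C : ℝ≥0, ∀ Q₀ : Set (Fin n → ℝ), IsCube Q₀ →
        ∀ f : (Fin n → ℝ) → ℝ, IntegrableOn f Q₀ →
          sjnNorm f p Q₀
            ≤ C * eLpNorm (fun x => f x - ⨍ y in Q₀, f y) p (volume.restrict Q₀) ∧
          eLpNorm (fun x => f x - ⨍ y in Q₀, f y) p (volume.restrict Q₀)
            ≤ C * sjnNorm f p Q₀) ∧
    -- the case p = ∞
    (∀ Q₀ : Set (Fin n → ℝ), IsCube Q₀ →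
      SJN ∞ Q₀ = DyadicBMO Q₀ ∧
      BMO Q₀ ⊆ SJN ∞ Q₀ ∧
      BMO Q₀ = {f | IntegrableOn f Q₀ ∧
        (⨆ (Q : Set (Fin n → ℝ)) (_ : IsCube Q) (_ : Q ⊆ Q₀), sjnNorm f ∞ Q) < ∞} ∧
      ∀ f : (Fin n → ℝ) → ℝ, IntegrableOn f Q₀ →
        sjnNorm f ∞ Q₀ = dyadicBmoNorm f Q₀ ∧
        (⨆ (Q : Set (Fin n → ℝ)) (_ : IsCube Q) (_ : Q ⊆ Q₀), sjnNorm f ∞ Q) = bmoNorm f Q₀) ∧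
    -- the case p = 1
    ((∀ Q₀ : Set (Fin n → ℝ), IsCube Q₀ → SJN 1 Q₀ = LLogL Q₀) ∧
      ∃ C : ℝ≥0, ∀ Q₀ : Set (Fin n → ℝ), IsCube Q₀ →
        ∀ f : (Fin n → ℝ) → ℝ, IntegrableOn f Q₀ →
          sjnNorm f 1 Q₀
            ≤ C * (volume Q₀ * llogLNorm (fun x => f x - ⨍ y in Q₀, f y) Q₀) ∧
          volume Q₀ * llogLNorm (fun x => f x - ⨍ y in Q₀, f y) Q₀
            ≤ C * sjnNorm f 1 Q₀) := by
  refine ⟨fun p hp1 hpt => ⟨fun Q₀ hQ₀ => SJN_eq_LpOn hn hQ₀ hp1 hpt, ?_⟩, fun Q₀ hQ₀ => ?_,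
    fun Q₀ hQ₀ => SJN_one_eq_LLogL hn hQ₀, ?_⟩
  · have hr1 : 1 < p.toReal := by
      rw [← ENNReal.toReal_one]; exact (ENNReal.toReal_lt_toReal (by simp) hpt.ne).2 hp1
    have hpq := Real.HolderConjugate.conjExponent hr1
    set q := p.toReal.conjExponent
    set C₁ : ℝ≥0∞ :=
      2 * ENNReal.ofReal (p.toReal * 2 ^ p.toReal / (p.toReal - 1)) ^ (1 / p.toReal) with hC₁
    set C₂ : ℝ≥0∞ :=
      2 ^ (n + 1) * (2 * ENNReal.ofReal (q * 2 ^ q / (q - 1)) ^ (1 / q)) with hC₂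
    have h1 : C₁ ≠ ∞ := ENNReal.mul_ne_top (by simp)
      (ENNReal.rpow_ne_top_of_nonneg (by positivity) (by simp))
    have h2 : C₂ ≠ ∞ := ENNReal.mul_ne_top (by simp) (ENNReal.mul_ne_top (by simp)
      (ENNReal.rpow_ne_top_of_nonneg (one_div_nonneg.2 hpq.symm.pos.le) (by simp)))
    -- The sum serves both inequalities. It depends on `n` and `p` only, as it is fixed before `Q₀`
    -- and `f`.
    refine ⟨(C₁ + C₂).toNNReal, fun Q₀ hQ₀ f hf => ?_⟩
    obtain ⟨lev, h⟩ := hQ₀.exists_isDyadicGrid hn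
    rw [ENNReal.coe_toNNReal (ENNReal.add_ne_top.2 ⟨h1, h2⟩)]
    constructor
    · exact (sjnNorm_le_eLpNorm h hp1 hpt hf).trans (mul_le_mul_left le_self_add _)
    · exact (eLpNorm_le_sjnNorm h hp1 hpt hpq hf).trans (mul_le_mul_left le_add_self _)
  · obtain ⟨lev, h⟩ := hQ₀.exists_isDyadicGrid hn
    refine ⟨?_, ?_, ?_, fun f _ => ⟨sjnNorm_top h f, iSup_sjnNorm_top hn f⟩⟩
    · simp only [SJN, DyadicBMO, sjnNorm_top h]
    · rintro f ⟨hf, hlt⟩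
      refine ⟨hf, ?_⟩
      rw [sjnNorm_top h]
      exact (dyadicBmoNorm_le_bmoNorm h f).trans_lt hlt
    · simp only [BMO, iSup_sjnNorm_top hn]
  · refine ⟨10 + (2 + 2 ^ n) * 2 ^ (n + 2), fun Q₀ hQ₀ f hf => ?_⟩
    obtain ⟨lev, h⟩ := hQ₀.exists_isDyadicGrid hn
    push_cast
    constructor
    · exact (sjnNorm_one_le_llogLNorm h hf).trans (mul_le_mul_left le_self_add _)
    · exact (llogLNorm_le_sjnNorm_one h hf).trans (mul_le_mul_left le_add_self _)
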